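/- Let $\Sigma\subset\mathbb{R}^3$ be the unit sphere with its surface measure, $B\ge 0$ the (positive) Laplace--Beltrami operator on $\Sigma$, and $k\in\mathbb{R}\setminus\{0\}$. Let $V(\tau,\theta)$ be real-valued, $V\in C^2([1,\infty)\times\Sigma)$. For $\tau_0,\tau\ge 1$ put $$U_0(k,\tau_0,\tau)=\exp\Big[\frac{1}{ik}\,\frac{\tau-\tau_0}{\tau\tau_0}\,B\Big],$$ and for $f\in L^2(\Sigma)$ let $W(k,\tau)f$, $\tau\ge 1$, be the solution of $$ik\,y_\tau=\tau^{-2}By+V(\tau,\cdot)\,y,\qquad y(1)=f,$$ given by its Duhamel expansion $W(k,\tau)f=\sum_{n\ge 0}T_n(\tau)$, where $T_0(\tau)=U_0(k,1,\tau)f$ and $T_{n+1}(\tau)=\frac{1}{ik}\int_1^\tau U_0(k,s,\tau)\,V(s,\cdot)\,T_n(s)\,ds$. Let $1/2<\gamma<1$ and suppose that for some constant $C$ and all $\tau\ge 1$ $$\|V(\tau,\cdot)\|_{L^\infty(\Sigma)}\le C,\qquad \|D_\theta V(\tau,\cdot)\|_{L^\infty(\Sigma)}\le C\tau^{-\gamma},\qquad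 \|D^2_\theta V(\tau,\cdot)\|_{L^\infty(\Sigma)}\le C\tau^{1-2\gamma},$$ where $D_\theta$ and $D_\theta^2$ are the differential and the Hessian in the variable $\theta\in\Sigma$ for the round metric. Then for every $f\in L^2(\Sigma)$ and $\tau\ge 1$ $$[W(k,\tau)f](\theta)=\exp\Big[(ik)^{-1}\int_1^\tau V(s,\theta)\,ds\Big]\cdot[W_{mod}(k,\tau)f](\theta)\quad\text{for a.e. }\theta\in\Sigma,$$ where $W_{mod}(k,\tau)f$ converges in $L^2(\Sigma)$, as $\tau\to\infty$, to a limit $W_{mod}(k,\infty)f$. -/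

import Mathlib

open scoped Manifold ContDiff
open MeasureTheory

noncomputable section

namespace ScalarWKB

/-- Three dimensional Euclidean space. -/
abbrev E3 : Type := EuclideanSpace ℝ (Fin 3)

/-- The two dimensional unit sphere `Σ`. -/
abbrev Sph : Type := Metric.sphere (0 : E3) 1

/-- The surface measure on the unit sphere (of total mass `4π`). -/
def surf : Measure Sph := (volume : Measure E3).toSphere

/-- The Hilbert space `L²(Σ)` of complex valued functions. -/
abbrev L2 : Type := Lp ℂ 2 surf

/-- The extension of a function on the sphere to `ℝ³ \ {0}` that is constant along rays,
`x ↦ g (x / |x|)` (with the irrelevant value `0` at the origin). -/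
def radialExt {α : Type} [Zero α] (g : Sph → α) (x : E3) : α :=
  open scoped Classical in
  if hx : x ≠ 0 then g ⟨‖x‖⁻¹ • x, by simp [norm_smul, hx]⟩ else 0

/-- The positive Laplace-Beltrami operator `B` of the round sphere on functions of class `C²`:
minus the Euclidean Laplacian of the extension that is constant along rays. -/
def laplaceBeltrami (g : Sph → ℂ) (θ : Sph) : ℂ :=
  -(Laplacian.laplacian (radialExt g) (θ : E3))

/-- The tangent plane of the sphere at `θ`, a subspace of `ℝ³` with the Euclidean norm. -/
abbrev tangentPlane (θ : Sph) : Submodule ℝ E3 := (Submodule.span ℝ {(θ : E3)})ᗮ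

/-- The differential at `θ` of a function on the sphere, a linear form on the tangent plane. -/
def angularD (g : Sph → ℝ) (θ : Sph) : tangentPlane θ →L[ℝ] ℝ :=
  (fderiv ℝ (radialExt g) (θ : E3)).comp (tangentPlane θ).subtypeL

/-- The second differential (covariant Hessian for the round metric) at `θ` of a function on the
sphere, a bilinear form on the tangent plane. As the extension is constant along rays, its
Euclidean Hessian restricted to tangent vectors has no second fundamental form term. -/
def angularD2 (g : Sph → ℝ) (θ : Sph) : tangentPlane θ →L[ℝ] tangentPlane θ →L[ℝ] ℝ :=
  (fderiv ℝ (fderiv ℝ (radialExt g)) (θ : E3)).bilinearComp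
    (tangentPlane θ).subtypeL (tangentPlane θ).subtypeL

/-- The (closed) eigenspace in `L²(Σ)` of the Laplace-Beltrami operator for the number `ev`,
spanned by the smooth eigenfunctions; it is zero if `ev` is not an eigenvalue. -/
def eigenspaceB (ev : ℝ) : Submodule ℂ L2 :=
  (Submodule.span ℂ {h : L2 | ∃ g : Sph → ℂ, ContMDiff (𝓡 2) 𝓘(ℝ, ℂ) ∞ g ∧
    (∀ θ, laplaceBeltrami g θ = (ev : ℂ) * g θ) ∧ (h : Sph → ℂ) =ᵐ[surf] g}).topologicalClosure

instance eigenspaceB_completeSpace (ev : ℝ) : CompleteSpace (eigenspaceB ev) :=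
  Submodule.topologicalClosure.completeSpace _

/-- `exp (z B)` for purely imaginary `z`, by the spectral theorem for the self-adjoint operator
`B`, whose spectrum is pure point: `exp (z B) f = ∑ exp (z ev) P_ev f`, the sum over the
eigenvalues `ev` of `B`, with `P_ev` the orthogonal projection onto the eigenspace. -/
def expB (z : ℂ) (f : L2) : L2 :=
  ∑' ev : ℝ, Complex.exp (z * (ev : ℂ)) • (eigenspaceB ev).starProjection f

/-- The free evolution `U₀(k, τ₀, τ) = exp [(ik)⁻¹ (τ - τ₀) / (τ τ₀) B]`. -/
def U0 (k τ₀ τ : ℝ) (f : L2) : L2 :=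
  expB ((Complex.I * (k : ℂ))⁻¹ * (((τ - τ₀) / (τ * τ₀) : ℝ) : ℂ)) f

/-- Multiplication of an element of `L²(Σ)` by a function `m` on the sphere. (The product is in
`L²(Σ)` whenever `m` is bounded and measurable; otherwise the value is `0` if it is not.) -/
def mulL2 (m : Sph → ℂ) (f : L2) : L2 :=
  open scoped Classical in
  if h : MemLp (fun θ => m θ * f θ) 2 surf then h.toLp _ else 0

/-- The terms of the Duhamel expansion of the solution of
`i k y_τ = τ⁻² B y + V y`, `y(τ₀) = f`. -/
def duhamelTerm (k : ℝ) (V : ℝ → Sph → ℝ) (τ₀ : ℝ) (f : L2) : ℕ → ℝ → L2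
  | 0, τ => U0 k τ₀ τ f
  | n + 1, τ => (Complex.I * (k : ℂ))⁻¹ •
      ∫ s in τ₀..τ, U0 k s τ (mulL2 (fun θ => (V s θ : ℂ)) (duhamelTerm k V τ₀ f n s))

/-- The evolution `U(k, τ₀, τ) f`, the sum of its Duhamel expansion. -/
def U (k : ℝ) (V : ℝ → Sph → ℝ) (τ₀ τ : ℝ) (f : L2) : L2 :=
  ∑' n : ℕ, duhamelTerm k V τ₀ f n τ

/-- `W(k, τ) f = U(k, 1, τ) f`. -/
def W (k : ℝ) (V : ℝ → Sph → ℝ) (τ : ℝ) (f : L2) : L2 := U k V 1 τ f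

end ScalarWKB

end

/-!
In the picture gauged by the WKB phase, `ψ(τ) = exp [-(i k)⁻¹ ∫₁^τ V] y(τ)` with
`i k y' = τ⁻² B y + V y`, the potential cancels and `i k ψ' = τ⁻² exp [-(i k)⁻¹ ∫₁^τ V] B y`. Hence
`ψ` converges as soon as `‖B y(τ)‖ = O(τ ^ δ)` with `δ < 1`. It suffices to show this for a dense
set of initial values, because the evolution and the gauge are isometries.

For finite combinations of spherical harmonics as initial values the bound holds with
`δ = 2 - 2 γ`. Indeed `d/dτ ‖B y‖² = 2 k⁻¹ Im ⟨B² y, V y⟩`, and the commutator estimate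
`abs_im_inner_mul_le` bounds the right-hand side by
`|D²V| ‖y‖ ‖B y‖ + |DV| ‖B^{1/2} y‖ ‖B y‖`, where `‖B^{1/2} y‖² ≤ ‖y‖ ‖B y‖`.
With `|DV| ≲ τ^{-γ}` and `|D²V| ≲ τ^{1-2γ}`, Young's inequality and a Gronwall argument
(`le_rpow_of_deriv_le`) give `‖B y‖ ≲ τ^{2-2γ}`.

Three points make this rigorous.

* Calculus on the sphere is done with the three rotation fields `x ↦ e_a × x`: the Laplace-Beltrami
  operator is `-∑ L_a²` (`laplaceBeltrami_eq`), and integration by parts follows from the rotation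
  invariance of the surface measure (`integral_angDeriv`).
* The operators `exp (z B)` are defined by the spectral projections on the eigenspaces. Restrictions
  of polynomials to the sphere are dense, and `B` does not raise the degree, so there is a Hilbert basis
  of smooth eigenfunctions (`exists_hilbertBasis_eigenfunctions`), in which the free evolution is
  diagonal (`HarmonicBasis.expB_eq`).
* The Duhamel series is the Dyson series in the interaction picture (`HarmonicBasis.W_eq`), whose
  generator is bounded. The energy estimate is proved for the Galerkin approximations, with a
  constant independent of the dimension (`HarmonicBasis.norm_diagFin_galerkin_le`), and passes to
  the limit; likewise `ψ` is differentiated after a spectral truncation, whose commutator with `V`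
  disappears in the limit (`HarmonicBasis.norm_gauge_sub_le`).
-/

noncomputable section

namespace ScalarWKB

/-! ### Differential calculus on the sphere by rotation fields -/

section Calculus

variable {F : Type} [NormedAddCommGroup F] [NormedSpace ℝ F]

omit [NormedSpace ℝ F] in
theorem radialExt_of_ne {g : Sph → F} {x : E3} (hx : x ≠ 0) :
    radialExt g x = g ⟨‖x‖⁻¹ • x, by simp [norm_smul, hx]⟩ := by
  simp [radialExt, hx]

theorem coe_ne_zero (θ : Sph) : (θ : E3) ≠ 0 := ne_zero_of_mem_unit_sphere θ

omit [NormedSpace ℝ F] in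
theorem radialExt_coe (g : Sph → F) (θ : Sph) : radialExt g (θ : E3) = g θ := by
  rw [radialExt_of_ne (coe_ne_zero θ)]
  congr 1
  ext1
  simp

omit [NormedSpace ℝ F] in
theorem radialExt_smul (g : Sph → F) {c : ℝ} (hc : 0 < c) (x : E3) :
    radialExt g (c • x) = radialExt g x := by
  by_cases hx : x = 0
  · simp [hx]
  · rw [radialExt_of_ne hx, radialExt_of_ne (smul_ne_zero hc.ne' hx)]
    congr 2
    rw [norm_smul, Real.norm_of_nonneg hc.le, smul_smul]
    congr 1
    field_simp

omit [NormedSpace ℝ F] in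
theorem radialExt_comp {F' : Type} [NormedAddCommGroup F'] (L : F → F') (hL : L 0 = 0)
    (g : Sph → F) : radialExt (fun θ => L (g θ)) = fun x => L (radialExt g x) := by
  ext x
  by_cases hx : x = 0 <;> simp [radialExt, hx, hL]

omit [NormedSpace ℝ F] in
theorem radialExt_add (g h : Sph → F) :
    radialExt (fun θ => g θ + h θ) = fun x => radialExt g x + radialExt h x := by
  ext x
  by_cases hx : x = 0 <;> simp [radialExt, hx]

theorem radialExt_mul (g h : Sph → ℂ) :
    radialExt (fun θ => g θ * h θ) = fun x => radialExt g x * radialExt h x := by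
  ext x
  by_cases hx : x = 0 <;> simp [radialExt, hx]

/-- A function on the sphere is of class `C^n` if its extension constant along rays is of
class `C^n` away from the origin. -/
def SphC (n : ℕ∞ω) (g : Sph → F) : Prop :=
  ∀ x : E3, x ≠ 0 → ContDiffAt ℝ n (radialExt g) x

theorem SphC.of_le {m n : ℕ∞ω} {g : Sph → F} (hg : SphC n g) (h : m ≤ n) : SphC m g :=
  fun x hx => (hg x hx).of_le h

theorem SphC.differentiableAt {n : ℕ∞ω} {g : Sph → F} (hg : SphC n g) (hn : 1 ≤ n) {x : E3}
    (hx : x ≠ 0) : DifferentiableAt ℝ (radialExt g) x :=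
  ((hg x hx).of_le hn).differentiableAt (by simp)

/-- The smooth structure of the sphere is available in the presence of this fact. -/
theorem finrank_E3_fact : Fact (Module.finrank ℝ E3 = 2 + 1) := ⟨by simp⟩

theorem SphC.contMDiff {n : ℕ∞ω} {g : Sph → F} (hg : SphC n g) :
    ContMDiff (𝓡 2) 𝓘(ℝ, F) n g := by
  have := finrank_E3_fact
  have h : g = radialExt g ∘ ((↑) : Sph → E3) := by
    ext θ
    exact (radialExt_coe g θ).symm
  rw [h]
  intro θ
  exact (hg θ (coe_ne_zero θ)).contMDiffAt.comp θ (contMDiff_coe_sphere θ)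

theorem SphC.continuous {n : ℕ∞ω} {g : Sph → F} (hg : SphC n g) : Continuous g :=
  hg.contMDiff.continuous

theorem contDiffAt_normalize {x : E3} (hx : x ≠ 0) {n : ℕ∞ω} :
    ContDiffAt ℝ n (fun y : E3 => ‖y‖⁻¹ • y) x :=
  ((contDiffAt_norm ℝ hx).inv (norm_ne_zero_iff.2 hx)).smul contDiffAt_id

theorem SphC.of_contMDiff {n : ℕ∞ω} {g : Sph → F} (hg : ContMDiff (𝓡 2) 𝓘(ℝ, F) n g) :
    SphC n g := by
  have := finrank_E3_fact
  intro x hx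
  let U : TopologicalSpace.Opens E3 := ⟨{0}ᶜ, isOpen_compl_singleton⟩
  let p : U → E3 := fun y => ‖(y : E3)‖⁻¹ • (y : E3)
  have hp : ContMDiff 𝓘(ℝ, E3) 𝓘(ℝ, E3) n p := by
    intro y
    have hy : (y : E3) ≠ 0 := y.2
    exact (contMDiffAt_subtype_iff (f := fun y : E3 => ‖y‖⁻¹ • y)).2
      (contDiffAt_normalize hy).contMDiffAt
  have hps : ∀ y : U, p y ∈ Metric.sphere (0 : E3) 1 := by
    intro y
    have hy : (y : E3) ≠ 0 := y.2
    simp [p, norm_smul, hy]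
  have h1 := hg.comp (hp.codRestrict_sphere (n := 2) hps)
  have h2 : ContMDiffAt 𝓘(ℝ, E3) 𝓘(ℝ, F) n (fun y : U => radialExt g y) ⟨x, hx⟩ := by
    have h3 : (fun y : U => radialExt g y) = g ∘ Set.codRestrict p _ hps := by
      ext y
      have hy : (y : E3) ≠ 0 := y.2
      simp only [Function.comp]
      rw [radialExt_of_ne hy]
      rfl
    rw [h3]
    exact h1 _
  exact (contMDiffAt_subtype_iff.1 h2).contDiffAt

theorem sphC_const (n : ℕ∞ω) (c : F) : SphC n (fun _ => c) :=
  SphC.of_contMDiff contMDiff_const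

theorem SphC.add {n : ℕ∞ω} {g h : Sph → F} (hg : SphC n g) (hh : SphC n h) :
    SphC n (fun θ => g θ + h θ) := by
  intro x hx
  rw [radialExt_add]
  exact (hg x hx).add (hh x hx)

theorem SphC.mul {n : ℕ∞ω} {g h : Sph → ℂ} (hg : SphC n g) (hh : SphC n h) :
    SphC n (fun θ => g θ * h θ) := by
  intro x hx
  rw [radialExt_mul]
  exact (hg x hx).mul (hh x hx)

theorem SphC.clm_comp {F' : Type} [NormedAddCommGroup F'] [NormedSpace ℝ F'] {n : ℕ∞ω}
    {g : Sph → F} (hg : SphC n g) (L : F →L[ℝ] F') : SphC n (fun θ => L (g θ)) := by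
  intro x hx
  rw [radialExt_comp L (map_zero L)]
  exact L.contDiff.contDiffAt.comp x (hg x hx)

/-- The infinitesimal rotation of space about the coordinate axis `a`, `x ↦ e_a × x`. -/
def rotGen (a : Fin 3) : E3 →L[ℝ] E3 :=
  LinearMap.toContinuousLinearMap
    { toFun := fun x => WithLp.toLp 2 (crossProduct (Pi.single a 1) (x.ofLp))
      map_add' := by intro x y; simp
      map_smul' := by intro c x; simp }

theorem rotGen_apply (a : Fin 3) (x : E3) :
    rotGen a x = WithLp.toLp 2 (crossProduct (Pi.single a 1) (x.ofLp)) := rfl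

/-- The derivative of a function on the sphere along the rotations about the coordinate
axis `a` (a component of the angular momentum). -/
def angDeriv (a : Fin 3) (g : Sph → F) (θ : Sph) : F :=
  fderiv ℝ (radialExt g) (θ : E3) (rotGen a θ)

theorem fderiv_radialExt_smul (g : Sph → F) {c : ℝ} (hc : 0 < c) (x : E3) :
    c • fderiv ℝ (radialExt g) (c • x) = fderiv ℝ (radialExt g) x := by
  have h := fderiv_comp_smul (f := radialExt g) (x := x) c (𝕜 := ℝ)
  rw [← h]
  congr 1
  ext y
  exact radialExt_smul g hc y

theorem radialExt_angDeriv (a : Fin 3) (g : Sph → F) :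
    radialExt (angDeriv a g) = fun x => fderiv ℝ (radialExt g) x (rotGen a x) := by
  ext x
  by_cases hx : x = 0
  · simp [hx, radialExt]
  · rw [radialExt_of_ne hx, angDeriv]
    have hc : 0 < ‖x‖⁻¹ := inv_pos.2 (norm_pos_iff.2 hx)
    simp only [map_smul]
    rw [← fderiv_radialExt_smul g hc x]
    simp

theorem SphC.angDeriv {n m : ℕ∞ω} {g : Sph → F} (hg : SphC n g) (hmn : m + 1 ≤ n) (a : Fin 3) :
    SphC m (angDeriv a g) := by
  intro x hx
  rw [radialExt_angDeriv]
  exact ((hg x hx).fderiv_right hmn).clm_apply (rotGen a).contDiff.contDiffAt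

theorem angDeriv_add {n : ℕ∞ω} (hn : 1 ≤ n) {g h : Sph → F} (hg : SphC n g) (hh : SphC n h)
    (a : Fin 3) (θ : Sph) :
    angDeriv a (fun θ => g θ + h θ) θ = angDeriv a g θ + angDeriv a h θ := by
  have hθ := coe_ne_zero θ
  rw [angDeriv, radialExt_add, fderiv_fun_add (hg.differentiableAt hn hθ)
    (hh.differentiableAt hn hθ)]
  rfl

theorem angDeriv_mul {n : ℕ∞ω} (hn : 1 ≤ n) {g h : Sph → ℂ} (hg : SphC n g) (hh : SphC n h)
    (a : Fin 3) (θ : Sph) :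
    angDeriv a (fun θ => g θ * h θ) θ = angDeriv a g θ * h θ + g θ * angDeriv a h θ := by
  have hθ := coe_ne_zero θ
  rw [angDeriv, radialExt_mul, fderiv_fun_mul (hg.differentiableAt hn hθ)
    (hh.differentiableAt hn hθ)]
  simp [angDeriv, radialExt_coe]
  ring

theorem angDeriv_clm_comp {F' : Type} [NormedAddCommGroup F'] [NormedSpace ℝ F'] {n : ℕ∞ω}
    (hn : 1 ≤ n) {g : Sph → F} (hg : SphC n g) (L : F →L[ℝ] F') (a : Fin 3) (θ : Sph) :
    angDeriv a (fun θ => L (g θ)) θ = L (angDeriv a g θ) := by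
  have hθ := coe_ne_zero θ
  rw [angDeriv, radialExt_comp L (map_zero L)]
  have := (L.hasFDerivAt.comp (θ : E3) (hg.differentiableAt hn hθ).hasFDerivAt).fderiv
  simp only [Function.comp_def] at this
  rw [this]
  rfl

theorem angDeriv_const (c : F) (a : Fin 3) (θ : Sph) : angDeriv a (fun _ => c) θ = 0 := by
  have h : (radialExt fun _ : Sph => c) =ᶠ[nhds (θ : E3)] fun _ => c := by
    filter_upwards [isOpen_ne.mem_nhds (coe_ne_zero θ)] with x hx
    rw [radialExt_of_ne hx]
  rw [angDeriv, h.fderiv_eq]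
  simp

/-- The value of the second derivative of a `C²` function along the rotation flow. -/
theorem angDeriv_angDeriv {g : Sph → F} (hg : SphC 2 g) (a : Fin 3) (θ : Sph) :
    angDeriv a (angDeriv a g) θ =
      fderiv ℝ (fderiv ℝ (radialExt g)) θ (rotGen a θ) (rotGen a θ) +
        fderiv ℝ (radialExt g) θ (rotGen a (rotGen a θ)) := by
  have hθ := coe_ne_zero θ
  have h1 : DifferentiableAt ℝ (fderiv ℝ (radialExt g)) (θ : E3) :=
    ((hg _ hθ).fderiv_right (m := 1) (by norm_num)).differentiableAt (by simp)
  have h2 := h1.hasFDerivAt.clm_apply ((rotGen a).hasFDerivAt (x := (θ : E3)))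
  rw [angDeriv, radialExt_angDeriv, h2.fderiv]
  simp [add_comm]

/-- Euler's relation for functions that are homogeneous of degree zero. -/
theorem fderiv_radialExt_self (g : Sph → F) (x : E3) :
    fderiv ℝ (radialExt g) x x = 0 := by
  by_cases hd : DifferentiableAt ℝ (radialExt g) x
  · have h1 : HasDerivAt (fun t : ℝ => t • x) x 1 := by
      simpa using (hasDerivAt_id (1 : ℝ)).smul_const x
    have hd' : HasFDerivAt (radialExt g) (fderiv ℝ (radialExt g) x) ((1 : ℝ) • x) := by
      simpa using hd.hasFDerivAt
    have h2 := hd'.comp_hasDerivAt (1 : ℝ) h1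
    have h3 : (radialExt g ∘ fun t : ℝ => t • x) =ᶠ[nhds 1] fun _ => radialExt g x := by
      filter_upwards [lt_mem_nhds (zero_lt_one (α := ℝ))] with t ht
      exact radialExt_smul g ht x
    exact h2.unique ((hasDerivAt_const (1 : ℝ) (radialExt g x)).congr_of_eventuallyEq h3)
  · rw [fderiv_zero_of_not_differentiableAt hd]; rfl

theorem fderiv_fderiv_radialExt_self {g : Sph → F} (hg : SphC 2 g) {x : E3} (hx : x ≠ 0) :
    fderiv ℝ (fderiv ℝ (radialExt g)) x x x = 0 := by
  have h1 : DifferentiableAt ℝ (fderiv ℝ (radialExt g)) x :=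
    ((hg _ hx).fderiv_right (m := 1) (by norm_num)).differentiableAt (by simp)
  have h2 := h1.hasFDerivAt.clm_apply (hasFDerivAt_id x)
  have h3 : (fun y => fderiv ℝ (radialExt g) y (id y)) =ᶠ[nhds x] fun _ => 0 := by
    filter_upwards [isOpen_ne.mem_nhds hx] with y hy
    exact fderiv_radialExt_self g y
  have h4 := h2.unique ((hasFDerivAt_const (0 : F) x).congr_of_eventuallyEq h3)
  have h5 := DFunLike.congr_fun h4 x
  simpa [fderiv_radialExt_self g x] using h5

theorem norm_sq_eq_coord (x : E3) : ‖x‖ ^ 2 = x 0 ^ 2 + x 1 ^ 2 + x 2 ^ 2 := by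
  rw [EuclideanSpace.norm_sq_eq, Fin.sum_univ_three]
  simp

theorem sum_rotGen_rotGen (x : E3) : ∑ a, rotGen a (rotGen a x) = (-2 : ℝ) • x := by
  ext i
  fin_cases i <;>
    simp [Fin.sum_univ_three, rotGen_apply, crossProduct, Pi.single_apply] <;> ring

/-- The trace of a bilinear form, in terms of its values on the rotation fields. -/
theorem sum_bilin_rotGen (T : E3 →L[ℝ] E3 →L[ℝ] F) (θ : Sph) :
    ∑ a, T (rotGen a θ) (rotGen a θ) =
      ∑ i, T (EuclideanSpace.basisFun (Fin 3) ℝ i) (EuclideanSpace.basisFun (Fin 3) ℝ i)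
        - T θ θ := by
  set b := EuclideanSpace.basisFun (Fin 3) ℝ with hb
  have hn : (θ : E3) 0 ^ 2 + (θ : E3) 1 ^ 2 + (θ : E3) 2 ^ 2 = 1 := by
    rw [← norm_sq_eq_coord]; simp
  have hx : (θ : E3) = (θ : E3) 0 • b 0 + (θ : E3) 1 • b 1 + (θ : E3) 2 • b 2 := by
    ext i; fin_cases i <;> simp [hb]
  have h0 : rotGen 0 θ = (-(θ : E3) 2) • b 1 + (θ : E3) 1 • b 2 := by
    ext i; fin_cases i <;> simp [hb, rotGen_apply, crossProduct]
  have h1 : rotGen 1 θ = (θ : E3) 2 • b 0 + (-(θ : E3) 0) • b 2 := by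
    ext i; fin_cases i <;> simp [hb, rotGen_apply, crossProduct]
  have h2 : rotGen 2 θ = (-(θ : E3) 1) • b 0 + (θ : E3) 0 • b 1 := by
    ext i; fin_cases i <;> simp [hb, rotGen_apply, crossProduct]
  rw [Fin.sum_univ_three, Fin.sum_univ_three, h0, h1, h2]
  generalize (θ : E3) 0 = p at *
  generalize (θ : E3) 1 = q at *
  generalize (θ : E3) 2 = r at *
  rw [hx]
  simp only [map_add, map_smul, add_apply, smul_apply]
  -- the two sides differ by the multiple `|θ|² - 1` of the full trace
  refine sub_eq_zero.1 (Eq.trans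
    (b := (p ^ 2 + q ^ 2 + r ^ 2 - 1) • (T (b 0) (b 0) + T (b 1) (b 1) + T (b 2) (b 2)))
    (by module) (by rw [hn]; simp))

/-- The first order terms of `∑ L_a²` are radial, so only the Hessian remains. -/
theorem sum_angDeriv_angDeriv {g : Sph → F} (hg : SphC 2 g) (θ : Sph) :
    ∑ a, angDeriv a (angDeriv a g) θ =
      ∑ a, fderiv ℝ (fderiv ℝ (radialExt g)) θ (rotGen a θ) (rotGen a θ) := by
  simp only [angDeriv_angDeriv hg, Finset.sum_add_distrib]
  rw [← map_sum, sum_rotGen_rotGen, map_smul, fderiv_radialExt_self]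
  simp

/-- The Laplace-Beltrami operator is minus the Casimir operator of the rotation group. -/
theorem laplaceBeltrami_eq {g : Sph → ℂ} (hg : SphC 2 g) (θ : Sph) :
    laplaceBeltrami g θ = -∑ a, angDeriv a (angDeriv a g) θ := by
  have hθ := coe_ne_zero θ
  rw [laplaceBeltrami, sum_angDeriv_angDeriv hg, sum_bilin_rotGen,
    fderiv_fderiv_radialExt_self hg hθ, sub_zero,
    InnerProductSpace.laplacian_eq_iteratedFDeriv_orthonormalBasis _
      (EuclideanSpace.basisFun (Fin 3) ℝ)]
  simp [iteratedFDeriv_two_apply]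

theorem rotGen_mem_tangent (a : Fin 3) (θ : Sph) : rotGen a θ ∈ tangentPlane θ := by
  rw [Submodule.mem_orthogonal_singleton_iff_inner_right, PiLp.inner_apply, Fin.sum_univ_three]
  fin_cases a <;> simp [rotGen_apply, crossProduct] <;> ring

theorem norm_rotGen_le (a : Fin 3) (x : E3) : ‖rotGen a x‖ ≤ ‖x‖ := by
  rw [← sq_le_sq₀ (norm_nonneg _) (norm_nonneg _), norm_sq_eq_coord, norm_sq_eq_coord]
  fin_cases a <;> simp [rotGen_apply, crossProduct] <;>
    nlinarith [sq_nonneg (x 0), sq_nonneg (x 1), sq_nonneg (x 2)]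

theorem abs_angDeriv_le {g : Sph → ℝ} {θ : Sph} {α : ℝ} (hα : 0 ≤ α)
    (h : ∀ u : tangentPlane θ, |angularD g θ u| ≤ α * ‖u‖) (a : Fin 3) :
    |angDeriv a g θ| ≤ α := by
  have h1 := h ⟨_, rotGen_mem_tangent a θ⟩
  have h2 : ‖rotGen a θ‖ ≤ 1 := (norm_rotGen_le a θ).trans (by simp)
  refine h1.trans ?_
  simpa using mul_le_mul_of_nonneg_left h2 hα

/-- A bound on the Hessian bounds the Laplacian; the factor three is the number of rotation
fields. -/
theorem abs_sum_angDeriv_angDeriv_le {g : Sph → ℝ} (hg : SphC 2 g) {θ : Sph} {β : ℝ}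
    (hβ : 0 ≤ β)
    (h : ∀ u v : tangentPlane θ, |angularD2 g θ u v| ≤ β * (‖u‖ * ‖v‖)) :
    |∑ a, angDeriv a (angDeriv a g) θ| ≤ 3 * β := by
  rw [sum_angDeriv_angDeriv hg]
  have h1 : ∀ a ∈ (Finset.univ : Finset (Fin 3)),
      |fderiv ℝ (fderiv ℝ (radialExt g)) θ (rotGen a θ) (rotGen a θ)| ≤ β := by
    intro a _
    have h1 := h ⟨_, rotGen_mem_tangent a θ⟩ ⟨_, rotGen_mem_tangent a θ⟩
    have h2 : ‖rotGen a θ‖ ≤ 1 := (norm_rotGen_le a θ).trans (by simp)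
    refine h1.trans ?_
    have h3 : ‖rotGen a θ‖ * ‖rotGen a θ‖ ≤ 1 := mul_le_one₀ h2 (norm_nonneg _) h2
    simpa using mul_le_mul_of_nonneg_left h3 hβ
  calc _ ≤ _ := Finset.abs_sum_le_sum_abs _ _
    _ ≤ _ := Finset.sum_le_sum h1
    _ = 3 * β := by simp

end Calculus

/-! ### Rotation invariance, integration by parts and the commutator estimate -/

section Rotation

instance surf_isFiniteMeasure : IsFiniteMeasure surf := by
  unfold surf; infer_instance

instance surf_isOpenPosMeasure : surf.IsOpenPosMeasure := by
  unfold surf; infer_instance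

/-- The rotation of space by the angle `t` about the coordinate axis `a` (Rodrigues' formula). -/
def rotation (a : Fin 3) (t : ℝ) : E3 →ₗᵢ[ℝ] E3 where
  toLinearMap := LinearMap.id + Real.sin t • (rotGen a : E3 →ₗ[ℝ] E3) +
    (1 - Real.cos t) • ((rotGen a : E3 →ₗ[ℝ] E3) ∘ₗ (rotGen a : E3 →ₗ[ℝ] E3))
  norm_map' := by
    intro x
    have h := Real.sin_sq_add_cos_sq t
    rw [← sq_eq_sq₀ (norm_nonneg _) (norm_nonneg _), norm_sq_eq_coord, norm_sq_eq_coord]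
    fin_cases a <;> simp [rotGen_apply, crossProduct]
    · linear_combination (x 1 ^ 2 + x 2 ^ 2) * h
    · linear_combination (x 0 ^ 2 + x 2 ^ 2) * h
    · linear_combination (x 0 ^ 2 + x 1 ^ 2) * h

theorem rotation_apply (a : Fin 3) (t : ℝ) (x : E3) :
    rotation a t x = x + Real.sin t • rotGen a x + (1 - Real.cos t) • rotGen a (rotGen a x) :=
  rfl

theorem rotGen_cube (a : Fin 3) (x : E3) : rotGen a (rotGen a (rotGen a x)) = -rotGen a x := by
  ext i
  fin_cases a <;> fin_cases i <;> simp [rotGen_apply, crossProduct]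

theorem hasDerivAt_rotation (a : Fin 3) (t : ℝ) (x : E3) :
    HasDerivAt (fun t => rotation a t x) (rotGen a (rotation a t x)) t := by
  have h := (((Real.hasDerivAt_sin t).smul_const (rotGen a x)).const_add x).add
    (((Real.hasDerivAt_cos t).const_sub 1).smul_const (rotGen a (rotGen a x)))
  have e : rotGen a (rotation a t x) =
      Real.cos t • rotGen a x + - -Real.sin t • rotGen a (rotGen a x) := by
    rw [rotation_apply]
    simp only [map_add, map_smul, rotGen_cube]
    module
  rw [e]
  exact h

/-- The action of a rotation on the sphere. -/
def rotSph (a : Fin 3) (t : ℝ) (θ : Sph) : Sph :=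
  ⟨rotation a t θ, by simp⟩

theorem continuous_rotSph (a : Fin 3) : Continuous fun p : ℝ × Sph => rotSph a p.1 p.2 := by
  refine Continuous.subtype_mk ?_ _
  simp only [rotation_apply]
  fun_prop

open scoped Pointwise in
theorem measurePreserving_sphere (R : E3 ≃ₗᵢ[ℝ] E3) (r : Sph → Sph)
    (hr : ∀ θ, (r θ : E3) = R θ) : MeasurePreserving r surf surf := by
  have hrm : Measurable r :=
    (continuous_induced_rng.2 (by simp only [Function.comp_def, hr]; fun_prop)).measurable
  refine ⟨hrm, ?_⟩
  ext s hs
  rw [Measure.map_apply hrm hs, surf, Measure.toSphere_apply' _ hs,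
    Measure.toSphere_apply' _ (hrm hs)]
  congr 1
  rw [← R.measurePreserving.measure_preimage_emb R.toHomeomorph.measurableEmbedding
    (Set.Ioo (0 : ℝ) 1 • (Subtype.val '' s))]
  congr 1
  ext x
  simp only [Set.mem_preimage, Set.mem_smul, Set.mem_image]
  constructor
  · rintro ⟨c, hc, _, ⟨θ, hθ, rfl⟩, rfl⟩
    exact ⟨c, hc, _, ⟨r θ, hθ, rfl⟩, by simp [hr]⟩
  · rintro ⟨c, hc, _, ⟨θ, hθ, rfl⟩, hx⟩
    refine ⟨c, hc, _, ⟨⟨R.symm θ, by simp⟩, ?_, rfl⟩, ?_⟩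
    · have : r ⟨R.symm θ, by simp⟩ = θ := by ext1; simp [hr]
      simpa [this] using hθ
    · apply R.injective
      simpa using hx

theorem measurePreserving_rotSph (a : Fin 3) (t : ℝ) : MeasurePreserving (rotSph a t) surf surf :=
  measurePreserving_sphere ((rotation a t).toLinearIsometryEquiv rfl) _ fun _ => rfl

variable {F : Type} [NormedAddCommGroup F] [NormedSpace ℝ F]

theorem hasDerivAt_comp_rotSph {g : Sph → F} (hg : SphC 1 g) (a : Fin 3) (θ : Sph) (t : ℝ) :
    HasDerivAt (fun t => g (rotSph a t θ)) (angDeriv a g (rotSph a t θ)) t := by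
  have h1 := (hg.differentiableAt le_rfl (coe_ne_zero (rotSph a t θ))).hasFDerivAt
  have h2 := h1.comp_hasDerivAt t (hasDerivAt_rotation a t θ)
  have e : (fun t => g (rotSph a t θ)) = radialExt g ∘ fun t => rotation a t θ := by
    ext s
    exact (radialExt_coe g (rotSph a s θ)).symm
  rw [e]
  exact h2

omit [NormedSpace ℝ F] in
theorem integrable_surf {g : Sph → F} (hg : Continuous g) : Integrable g surf :=
  hg.integrable_of_hasCompactSupport (HasCompactSupport.of_compactSpace g)

theorem SphC.continuous_angDeriv {n : ℕ∞ω} (hn : 1 ≤ n) {g : Sph → F} (hg : SphC n g)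
    (a : Fin 3) : Continuous (ScalarWKB.angDeriv a g) :=
  SphC.continuous (n := 0) ((hg.of_le hn).angDeriv (by simp) a)

/-- The surface integral of an angular derivative vanishes, by the invariance of the surface
measure under rotations. -/
theorem integral_angDeriv [CompleteSpace F] {g : Sph → F} (hg : SphC 1 g) (a : Fin 3) :
    ∫ θ, angDeriv a g θ ∂surf = 0 := by
  have hc := hg.continuous_angDeriv le_rfl a
  -- averaged over a full turn the derivative integrates to zero, and by invariance averaging does
  -- not change the surface integral
  have h1 : ∀ θ, ∫ t in (0 : ℝ)..2 * Real.pi, angDeriv a g (rotSph a t θ) = 0 := by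
    intro θ
    rw [intervalIntegral.integral_eq_sub_of_hasDerivAt
      (fun t _ => hasDerivAt_comp_rotSph hg a θ t)]
    · have : rotSph a (2 * Real.pi) θ = rotSph a 0 θ := by
        ext1
        simp [rotSph, rotation_apply]
      rw [this, sub_self]
    · exact (hc.comp ((continuous_rotSph a).comp (by fun_prop : Continuous
        fun t : ℝ => (t, θ)))).intervalIntegrable _ _
  have h2 : ∀ t, ∫ θ, angDeriv a g (rotSph a t θ) ∂surf = ∫ θ, angDeriv a g θ ∂surf := by
    intro t
    have hm := measurePreserving_rotSph a t
    conv_rhs => rw [← hm.map_eq]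
    rw [integral_map hm.measurable.aemeasurable hc.aestronglyMeasurable]
  have h3 := intervalIntegral_integral_swap (μ := surf) (a := 0) (b := 2 * Real.pi)
    (f := fun t θ => angDeriv a g (rotSph a t θ)) ?_
  · simp only [h1, h2] at h3
    simpa [Real.pi_ne_zero] using h3
  · rw [← Measure.restrict_univ (μ := surf), Measure.prod_restrict]
    refine IntegrableOn.mono_set (ContinuousOn.integrableOn_compact
      ((isCompact_uIcc (a := 0) (b := 2 * Real.pi)).prod isCompact_univ)
      (hc.comp (continuous_rotSph a)).continuousOn) ?_
    exact Set.prod_mono Set.uIoc_subset_uIcc le_rfl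

/-- Integration by parts on the sphere. -/
theorem integral_angDeriv_mul {g h : Sph → ℂ} (hg : SphC 1 g) (hh : SphC 1 h) (a : Fin 3) :
    ∫ θ, angDeriv a g θ * h θ ∂surf = -∫ θ, g θ * angDeriv a h θ ∂surf := by
  have h1 := integral_angDeriv (hg.mul hh) a
  simp only [angDeriv_mul le_rfl hg hh] at h1
  rw [integral_add] at h1
  · exact eq_neg_of_add_eq_zero_left h1
  · exact integrable_surf ((hg.continuous_angDeriv le_rfl a).mul hh.continuous)
  · exact integrable_surf (hg.continuous.mul (hh.continuous_angDeriv le_rfl a))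

theorem SphC.continuous_laplaceBeltrami {g : Sph → ℂ} (hg : SphC 2 g) :
    Continuous (laplaceBeltrami g) := by
  have : laplaceBeltrami g = fun θ => -∑ a, ScalarWKB.angDeriv a (ScalarWKB.angDeriv a g) θ := by
    ext θ; exact laplaceBeltrami_eq hg θ
  rw [this]
  refine (continuous_finsetSum _ fun a _ => ?_).neg
  exact SphC.continuous_angDeriv le_rfl (hg.angDeriv (by norm_num) a) a

/-- Green's first identity on the sphere. -/
theorem integral_laplaceBeltrami_mul {g h : Sph → ℂ} (hg : SphC 2 g) (hh : SphC 1 h) :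
    ∫ θ, laplaceBeltrami g θ * h θ ∂surf =
      ∑ a, ∫ θ, angDeriv a g θ * angDeriv a h θ ∂surf := by
  have h1 : ∀ a, SphC 1 (angDeriv a g) := fun a => hg.angDeriv (by norm_num) a
  simp only [laplaceBeltrami_eq hg, neg_mul, Finset.sum_mul, integral_neg]
  rw [integral_finsetSum, ← Finset.sum_neg_distrib]
  · refine Finset.sum_congr rfl fun a _ => ?_
    rw [integral_angDeriv_mul (h1 a) hh, neg_neg]
  · intro a _
    exact integrable_surf (((h1 a).continuous_angDeriv le_rfl a).mul hh.continuous)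

theorem integral_laplaceBeltrami_symm {g h : Sph → ℂ} (hg : SphC 2 g) (hh : SphC 2 h) :
    ∫ θ, laplaceBeltrami g θ * h θ ∂surf = ∫ θ, g θ * laplaceBeltrami h θ ∂surf := by
  have e : ∀ θ, g θ * laplaceBeltrami h θ = laplaceBeltrami h θ * g θ := fun θ => mul_comm _ _
  simp only [e]
  rw [integral_laplaceBeltrami_mul hg (hh.of_le (by norm_num)),
    integral_laplaceBeltrami_mul hh (hg.of_le (by norm_num))]
  simp only [mul_comm]

theorem SphC.conj {n : ℕ∞ω} {g : Sph → ℂ} (hg : SphC n g) :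
    SphC n (fun θ => (starRingEnd ℂ) (g θ)) :=
  hg.clm_comp (Complex.conjCLE : ℂ →L[ℝ] ℂ)

theorem angDeriv_conj {g : Sph → ℂ} (hg : SphC 1 g) (a : Fin 3) (θ : Sph) :
    angDeriv a (fun θ => (starRingEnd ℂ) (g θ)) θ = (starRingEnd ℂ) (angDeriv a g θ) :=
  angDeriv_clm_comp le_rfl hg (Complex.conjCLE : ℂ →L[ℝ] ℂ) a θ

theorem laplaceBeltrami_conj {g : Sph → ℂ} (hg : SphC 2 g) (θ : Sph) :
    laplaceBeltrami (fun θ => (starRingEnd ℂ) (g θ)) θ = (starRingEnd ℂ) (laplaceBeltrami g θ) := by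
  rw [laplaceBeltrami_eq hg, laplaceBeltrami_eq hg.conj, map_neg, map_sum]
  congr 1
  refine Finset.sum_congr rfl fun a _ => ?_
  have h1 : angDeriv a (fun θ => (starRingEnd ℂ) (g θ)) =
      fun θ => (starRingEnd ℂ) (angDeriv a g θ) := by
    ext θ; exact angDeriv_conj (hg.of_le (by norm_num)) a θ
  rw [h1, angDeriv_conj (hg.angDeriv (by norm_num) a)]

theorem laplaceBeltrami_add {g h : Sph → ℂ} (hg : SphC 2 g) (hh : SphC 2 h) (θ : Sph) :
    laplaceBeltrami (fun θ => g θ + h θ) θ = laplaceBeltrami g θ + laplaceBeltrami h θ := by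
  rw [laplaceBeltrami_eq hg, laplaceBeltrami_eq hh, laplaceBeltrami_eq (hg.add hh), ← neg_add,
    ← Finset.sum_add_distrib]
  congr 1
  refine Finset.sum_congr rfl fun a _ => ?_
  have h1 : angDeriv a (fun θ => g θ + h θ) = fun θ => angDeriv a g θ + angDeriv a h θ := by
    ext θ; exact angDeriv_add (n := 2) (by norm_num) hg hh a θ
  rw [h1, angDeriv_add (n := 1) le_rfl (hg.angDeriv (by norm_num) a) (hh.angDeriv (by norm_num) a)]

/-- The Leibniz rule for the Laplace-Beltrami operator. -/
theorem laplaceBeltrami_mul {g h : Sph → ℂ} (hg : SphC 2 g) (hh : SphC 2 h) (θ : Sph) :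
    laplaceBeltrami (fun θ => g θ * h θ) θ = g θ * laplaceBeltrami h θ +
      (laplaceBeltrami g θ * h θ - 2 * ∑ a, angDeriv a g θ * angDeriv a h θ) := by
  rw [laplaceBeltrami_eq hg, laplaceBeltrami_eq hh, laplaceBeltrami_eq (hg.mul hh)]
  have h1 : ∀ a, angDeriv a (fun θ => g θ * h θ) =
      fun θ => angDeriv a g θ * h θ + g θ * angDeriv a h θ := by
    intro a; ext θ; exact angDeriv_mul (n := 2) (by norm_num) hg hh a θ
  have h2 : ∀ a, SphC 1 (angDeriv a g) := fun a => hg.angDeriv (by norm_num) a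
  have h3 : ∀ a, SphC 1 (angDeriv a h) := fun a => hh.angDeriv (by norm_num) a
  have hg1 : SphC 1 g := hg.of_le (by norm_num)
  have hh1 : SphC 1 h := hh.of_le (by norm_num)
  simp only [h1, angDeriv_add le_rfl ((h2 _).mul hh1) (hg1.mul (h3 _)),
    angDeriv_mul le_rfl (h2 _) hh1, angDeriv_mul le_rfl hg1 (h3 _), Fin.sum_univ_three]
  ring

theorem laplaceBeltrami_const (c : ℂ) (θ : Sph) : laplaceBeltrami (fun _ => c) θ = 0 := by
  rw [laplaceBeltrami_eq (sphC_const 2 c)]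
  have h1 : ∀ a, angDeriv a (fun _ : Sph => c) = fun _ => 0 := by
    intro a; ext θ; exact angDeriv_const c a θ
  simp [h1, angDeriv_const]

theorem laplaceBeltrami_const_mul (c : ℂ) {g : Sph → ℂ} (hg : SphC 2 g) (θ : Sph) :
    laplaceBeltrami (fun θ => c * g θ) θ = c * laplaceBeltrami g θ := by
  rw [laplaceBeltrami_mul (sphC_const 2 c) hg]
  simp [laplaceBeltrami_const, angDeriv_const]

theorem SphC.laplaceBeltrami {n : ℕ∞ω} {g : Sph → ℂ} (hg : SphC n g) {m : ℕ∞ω} (h : m + 2 ≤ n) :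
    SphC m (laplaceBeltrami g) := by
  have h1 : (m + 1) + 1 ≤ n := by rwa [add_assoc, one_add_one_eq_two]
  have h2 : ∀ a, SphC m (ScalarWKB.angDeriv a (ScalarWKB.angDeriv a g)) := fun a =>
    (hg.angDeriv h1 a).angDeriv le_rfl a
  have h3 : ScalarWKB.laplaceBeltrami g = fun θ => -(ScalarWKB.angDeriv 0 (ScalarWKB.angDeriv 0 g) θ
      + ScalarWKB.angDeriv 1 (ScalarWKB.angDeriv 1 g) θ
      + ScalarWKB.angDeriv 2 (ScalarWKB.angDeriv 2 g) θ) := by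
    ext θ
    rw [laplaceBeltrami_eq (hg.of_le (le_trans (by simp) h)), Fin.sum_univ_three]
  rw [h3]
  exact (((h2 0).add (h2 1)).add (h2 2)).clm_comp (-ContinuousLinearMap.id ℝ ℂ)

theorem inner_toLp_eq_integral (g h : C(Sph, ℂ)) :
    inner ℂ (ContinuousMap.toLp 2 surf ℂ g) (ContinuousMap.toLp 2 surf ℂ h) =
      ∫ θ, (starRingEnd ℂ) (g θ) * h θ ∂surf := by
  rw [ContinuousMap.inner_toLp]
  simp only [mul_comm]

theorem norm_toLp_mul_le {c : ℝ} {p q : C(Sph, ℂ)} (hp : ∀ θ, ‖p θ‖ ≤ c) :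
    ‖ContinuousMap.toLp 2 surf ℂ (p * q)‖ ≤ c * ‖ContinuousMap.toLp 2 surf ℂ q‖ := by
  refine Lp.norm_le_mul_norm_of_ae_le_mul ?_
  filter_upwards [ContinuousMap.coeFn_toLp surf (𝕜 := ℂ) (p := 2) (p * q),
    ContinuousMap.coeFn_toLp surf (𝕜 := ℂ) (p := 2) q] with θ h1 h2
  rw [h1, h2, ContinuousMap.mul_apply, norm_mul]
  exact mul_le_mul_of_nonneg_right (hp θ) (norm_nonneg _)

/-- The Laplace-Beltrami operator is symmetric on `C²` functions. -/
theorem inner_toLp_laplaceBeltrami {g h : C(Sph, ℂ)} (hg : SphC 2 g) (hh : SphC 2 h)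
    (bg bh : C(Sph, ℂ)) (hbg : ∀ θ, bg θ = laplaceBeltrami g θ)
    (hbh : ∀ θ, bh θ = laplaceBeltrami h θ) :
    inner ℂ (ContinuousMap.toLp 2 surf ℂ bg) (ContinuousMap.toLp 2 surf ℂ h) =
      inner ℂ (ContinuousMap.toLp 2 surf ℂ g) (ContinuousMap.toLp 2 surf ℂ bh) := by
  rw [inner_toLp_eq_integral, inner_toLp_eq_integral]
  simp only [hbg, hbh, ← laplaceBeltrami_conj hg]
  exact integral_laplaceBeltrami_symm hg.conj hh

/-- `‖B^{1/2} y‖² = ⟨y, B y⟩`, with the gradient in terms of the rotation fields. -/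
theorem sum_norm_toLp_angDeriv_sq {y : C(Sph, ℂ)} (hy : SphC 2 y) (w : C(Sph, ℂ))
    (hw : ∀ θ, w θ = laplaceBeltrami y θ) (ya : Fin 3 → C(Sph, ℂ))
    (hya : ∀ a θ, ya a θ = angDeriv a y θ) :
    ((∑ a, ‖ContinuousMap.toLp 2 surf ℂ (ya a)‖ ^ 2 : ℝ) : ℂ) =
      inner ℂ (ContinuousMap.toLp 2 surf ℂ y) (ContinuousMap.toLp 2 surf ℂ w) := by
  have h1 : ∀ a, ((‖ContinuousMap.toLp 2 surf ℂ (ya a)‖ ^ 2 : ℝ) : ℂ) =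
      ∫ θ, angDeriv a y θ * angDeriv a (fun θ => (starRingEnd ℂ) (y θ)) θ ∂surf := by
    intro a
    have := inner_self_eq_norm_sq_to_K (𝕜 := ℂ) (ContinuousMap.toLp 2 surf ℂ (ya a))
    rw [inner_toLp_eq_integral] at this
    simp only [angDeriv_conj (hy.of_le (by norm_num : (1 : ℕ∞ω) ≤ 2)), ← hya]
    simp only [mul_comm (ya a _)]
    rw [this]
    norm_cast
  rw [Complex.ofReal_sum]
  simp only [h1]
  rw [← integral_laplaceBeltrami_mul hy (hy.conj.of_le (by norm_num)), inner_toLp_eq_integral]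
  simp only [hw, mul_comm]

/-- The commutator estimate: for a real `V` whose first and second angular derivatives are
bounded by `α` and `β`, the imaginary part of `⟨V y, B² y⟩` is controlled with a loss of only
one derivative of `y`. -/
theorem abs_im_inner_mul_le {V : Sph → ℝ} (hV : SphC 2 V) {α β : ℝ} (hα : 0 ≤ α)
    (h1 : ∀ a θ, |angDeriv a V θ| ≤ α) (h2 : ∀ θ, |∑ a, angDeriv a (angDeriv a V) θ| ≤ β)
    (y w u m : C(Sph, ℂ)) (hy : SphC ∞ y) (hw : ∀ θ, w θ = laplaceBeltrami y θ)
    (hu : ∀ θ, u θ = laplaceBeltrami w θ) (hm : ∀ θ, m θ = V θ * y θ) :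
    |(inner ℂ (ContinuousMap.toLp 2 surf ℂ m) (ContinuousMap.toLp 2 surf ℂ u)).im| ≤
      (β * ‖ContinuousMap.toLp 2 surf ℂ y‖ + 6 * α *
        √(‖ContinuousMap.toLp 2 surf ℂ y‖ * ‖ContinuousMap.toLp 2 surf ℂ w‖)) *
        ‖ContinuousMap.toLp 2 surf ℂ w‖ := by
  set T := ContinuousMap.toLp 2 surf ℂ (E := ℂ) with hT
  have hy2 : SphC 2 y := hy.of_le (WithTop.coe_le_coe.2 le_top)
  have hy1 : SphC 1 y := hy2.of_le (by norm_num)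
  have hwe : (w : Sph → ℂ) = laplaceBeltrami y := funext hw
  have hw2 : SphC 2 w := by
    rw [hwe]
    exact hy.laplaceBeltrami (WithTop.coe_le_coe.2 le_top)
  let Vc : Sph → ℂ := fun θ => (V θ : ℂ)
  have hVc : SphC 2 Vc := hV.clm_comp Complex.ofRealCLM
  have hVd : ∀ a θ, angDeriv a Vc θ = ((angDeriv a V θ : ℝ) : ℂ) := fun a θ =>
    angDeriv_clm_comp (n := 2) (by norm_num) hV Complex.ofRealCLM a θ
  have hVdd : ∀ θ, laplaceBeltrami Vc θ = ((-∑ a, angDeriv a (angDeriv a V) θ : ℝ) : ℂ) := by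
    intro θ
    rw [laplaceBeltrami_eq hVc]
    push_cast
    congr 1
    refine Finset.sum_congr rfl fun a _ => ?_
    rw [show angDeriv a Vc = fun θ => Complex.ofRealCLM (angDeriv a V θ) from
      funext fun θ => hVd a θ]
    exact angDeriv_clm_comp (n := 1) le_rfl (hV.angDeriv (by norm_num) a) Complex.ofRealCLM a θ
  have hme : (m : Sph → ℂ) = fun θ => Vc θ * y θ := funext hm
  have hm2 : SphC 2 m := by
    rw [hme]
    exact hVc.mul hy2
  let ya : Fin 3 → C(Sph, ℂ) := fun a => ⟨angDeriv a y, hy1.continuous_angDeriv le_rfl a⟩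
  let va : Fin 3 → C(Sph, ℂ) := fun a =>
    ⟨angDeriv a Vc, hVc.continuous_angDeriv (by norm_num) a⟩
  let Vm : C(Sph, ℂ) := ⟨Vc, hVc.continuous⟩
  let lV : C(Sph, ℂ) := ⟨laplaceBeltrami Vc, hVc.continuous_laplaceBeltrami⟩
  let Bm : C(Sph, ℂ) := ⟨laplaceBeltrami m, hm2.continuous_laplaceBeltrami⟩
  have hBm : Bm = Vm * w + (lV * y - (2 : ℂ) • ∑ a, va a * ya a) := by
    ext θ
    have := laplaceBeltrami_mul hVc hy2 θ
    rw [← hme] at this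
    simp only [Bm, ContinuousMap.coe_mk, this, ← hw]
    simp [Vm, lV, va, ya]
  -- moving one `B` across, `B (V y) = V B y + [B, V] y`; the first term gives a real number
  have e1 : inner ℂ (T m) (T u) = inner ℂ (T Bm) (T w) :=
    (inner_toLp_laplaceBeltrami hm2 hw2 Bm u (fun _ => rfl) hu).symm
  have e2 : (inner ℂ (T (Vm * w)) (T w)).im = 0 := by
    rw [hT, inner_toLp_eq_integral]
    have : ∀ θ, (starRingEnd ℂ) ((Vm * w) θ) * w θ = ((V θ * Complex.normSq (w θ) : ℝ) : ℂ) := by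
      intro θ
      simp [Vm, Vc, mul_assoc, Complex.normSq_eq_conj_mul_self]
    simp only [this, integral_complex_ofReal]
    simp
  have hz0 : 0 ≤ √(‖T y‖ * ‖T w‖) := Real.sqrt_nonneg _
  have hya : ∀ a, ‖T (ya a)‖ ≤ √(‖T y‖ * ‖T w‖) := by
    intro a
    apply Real.le_sqrt_of_sq_le
    calc ‖T (ya a)‖ ^ 2 ≤ ∑ a, ‖T (ya a)‖ ^ 2 :=
          Finset.single_le_sum (f := fun a => ‖T (ya a)‖ ^ 2) (fun i _ => sq_nonneg _)
            (Finset.mem_univ a)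
      _ = (inner ℂ (T y) (T w)).re := by
          rw [← sum_norm_toLp_angDeriv_sq hy2 w hw ya fun _ _ => rfl, Complex.ofReal_re]
      _ ≤ ‖inner ℂ (T y) (T w)‖ := Complex.re_le_norm _
      _ ≤ _ := norm_inner_le_norm _ _
  have hr : ‖T (lV * y - (2 : ℂ) • ∑ a, va a * ya a)‖ ≤
      β * ‖T y‖ + 6 * α * √(‖T y‖ * ‖T w‖) := by
    rw [map_sub, map_smul, map_sum]
    have b1 : ‖T (lV * y)‖ ≤ β * ‖T y‖ := by
      refine norm_toLp_mul_le fun θ => ?_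
      simp only [lV, ContinuousMap.coe_mk, hVdd, Complex.norm_real, Real.norm_eq_abs, abs_neg]
      exact h2 θ
    have b2 : ∀ a ∈ Finset.univ, ‖T (va a * ya a)‖ ≤ α * √(‖T y‖ * ‖T w‖) := by
      intro a _
      refine (norm_toLp_mul_le (c := α) fun θ => ?_).trans
        (mul_le_mul_of_nonneg_left (hya a) hα)
      simp only [va, ContinuousMap.coe_mk, hVd, Complex.norm_real, Real.norm_eq_abs]
      exact h1 a θ
    have b3 := norm_sum_le_of_le _ b2
    rw [Finset.sum_const, Finset.card_univ, Fintype.card_fin, nsmul_eq_mul] at b3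
    have b4 := norm_sub_le (T (lV * y)) ((2 : ℂ) • ∑ a, T (va a * ya a))
    rw [norm_smul, Complex.norm_ofNat] at b4
    push_cast at b3
    linarith
  rw [e1, hBm, map_add, inner_add_left, Complex.add_im, e2, zero_add]
  exact (Complex.abs_im_le_norm _).trans ((norm_inner_le_norm _ _).trans
    (mul_le_mul_of_nonneg_right hr (norm_nonneg _)))

end Rotation

/-! ### Spherical harmonics -/

section Harmonics

/-- A symmetric operator on a pre-Hilbert space that leaves the members of an increasing
sequence of finite dimensional subspaces invariant has an orthonormal family of eigenvectors whose
span contains all of them. -/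
theorem exists_orthonormal_eigenvectors {D : Type} [NormedAddCommGroup D] [InnerProductSpace ℂ D]
    {A : D →ₗ[ℂ] D} (hA : A.IsSymmetric) (Y : ℕ → Submodule ℂ D)
    [∀ n, FiniteDimensional ℂ (Y n)] (hmono : Monotone Y) (hinv : ∀ n, ∀ v ∈ Y n, A v ∈ Y n) :
    ∃ (ι : Type) (_ : Countable ι) (v : ι → D) (lam : ι → ℝ), Orthonormal ℂ v ∧
      (∀ j, A (v j) = (lam j : ℂ) • v j) ∧ ∀ n, Y n ≤ Submodule.span ℂ (Set.range v) := by
  -- diagonalize `A` on the successive orthogonal complements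
  let Z : ℕ → Submodule ℂ D := fun n => match n with
    | 0 => Y 0
    | n + 1 => (Y n)ᗮ ⊓ Y (n + 1)
  have hZY : ∀ n, Z n ≤ Y n := by
    rintro (_ | n)
    · exact le_rfl
    · exact inf_le_right
  have : ∀ n, FiniteDimensional ℂ (Z n) := fun n => Submodule.finiteDimensional_of_le (hZY n)
  have hZinv : ∀ n, ∀ v ∈ Z n, A v ∈ Z n := by
    rintro (_ | n) v hv
    · exact hinv 0 v hv
    · refine ⟨?_, hinv _ v hv.2⟩
      intro u hu
      rw [← hA]
      exact hv.1 _ (hinv n u hu)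
  have hlt : ∀ m n, m < n → Z m ⟂ Z n := by
    rintro m (_ | n) hmn
    · exact absurd hmn (Nat.not_lt_zero _)
    · have h1 : Z (n + 1) ≤ (Y n)ᗮ := inf_le_left
      exact (Submodule.isOrtho_iff_le.2 (h1.trans (Submodule.orthogonal_le
        ((hZY m).trans (hmono (Nat.lt_succ_iff.1 hmn)))))).symm
  have hpair : Pairwise (Function.onFun (fun x y => x ⟂ y) Z) := by
    intro m n hmn
    rcases lt_or_gt_of_ne hmn with h | h
    · exact hlt m n h
    · exact (hlt n m h).symm
  have hS : ∀ n, (A.restrict (hZinv n)).IsSymmetric := fun n => hA.restrict_invariant (hZinv n)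
  let e := fun n => (hS n).eigenvectorBasis rfl
  have horth := (OrthogonalFamily.of_pairwise hpair).orthonormal_sigma_orthonormal
    (fun n => (e n).orthonormal)
  refine ⟨Σ n, Fin (Module.finrank ℂ (Z n)), inferInstance, _,
    fun j => (hS j.1).eigenvalues rfl j.2, horth, ?_, ?_⟩
  · rintro ⟨n, i⟩
    exact congrArg Subtype.val ((hS n).apply_eigenvectorBasis rfl i)
  · have hZspan : ∀ n, Z n ≤ Submodule.span ℂ (Set.range
        fun j : Σ n, Fin (Module.finrank ℂ (Z n)) => (Z j.1).subtypeₗᵢ (e j.1 j.2)) := by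
      intro n v hv
      have h1 := (e n).sum_repr ⟨v, hv⟩
      have h2 := congrArg Subtype.val h1
      simp only [AddSubmonoidClass.coe_finsetSum, Submodule.coe_smul] at h2
      rw [← h2]
      refine Submodule.sum_mem _ fun i _ => Submodule.smul_mem _ _ (Submodule.subset_span ?_)
      exact ⟨⟨n, i⟩, rfl⟩
    intro n
    induction n with
    | zero => exact hZspan 0
    | succ n ih =>
      rw [← Submodule.sup_orthogonal_inf_of_hasOrthogonalProjection (hmono n.le_succ)]
      exact sup_le ih (hZspan (n + 1))

/-- The continuous functions on the sphere that are of class `C^∞`. -/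
def smoothFun : Submodule ℂ C(Sph, ℂ) where
  carrier := {g | SphC ∞ g}
  add_mem' hg hh := hg.add hh
  zero_mem' := sphC_const ∞ 0
  smul_mem' c _ hg := (sphC_const ∞ c).mul hg

theorem two_le_smooth : (2 : ℕ∞ω) ≤ ∞ := WithTop.coe_le_coe.2 le_top

/-- The Laplace-Beltrami operator on smooth functions. -/
def laplaceSmooth : smoothFun →ₗ[ℂ] smoothFun where
  toFun g := ⟨⟨laplaceBeltrami g.1, (g.2.of_le two_le_smooth).continuous_laplaceBeltrami⟩,
    g.2.laplaceBeltrami (m := ∞) le_rfl⟩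
  map_add' g h := by
    ext θ
    exact laplaceBeltrami_add (g.2.of_le two_le_smooth) (h.2.of_le two_le_smooth) θ
  map_smul' c g := by
    ext θ
    exact laplaceBeltrami_const_mul c (g.2.of_le two_le_smooth) θ

theorem sphC_linear {F : Type} [NormedAddCommGroup F] [NormedSpace ℝ F] (L : E3 →L[ℝ] F) :
    SphC ∞ fun θ : Sph => L θ := by
  have := finrank_E3_fact
  exact SphC.of_contMDiff (L.contMDiff.comp contMDiff_coe_sphere)

theorem angDeriv_linear {F : Type} [NormedAddCommGroup F] [NormedSpace ℝ F] (L : E3 →L[ℝ] F)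
    (a : Fin 3) (θ : Sph) : angDeriv a (fun θ : Sph => L θ) θ = L (rotGen a θ) := by
  have h0 : ∀ x, rotation a 0 x = x := fun x => by simp [rotation_apply]
  have h1 := hasDerivAt_comp_rotSph ((sphC_linear L).of_le (by norm_num)) a θ 0
  have h2 := L.hasFDerivAt.comp_hasDerivAt (0 : ℝ) (hasDerivAt_rotation a 0 (θ : E3))
  have h3 : rotSph a 0 θ = θ := Subtype.ext (h0 _)
  rw [h3] at h1
  rw [h0] at h2
  exact h1.unique h2

/-- The restriction to the sphere of a linear form with complex values. -/
def linearFun (L : E3 →L[ℝ] ℂ) : C(Sph, ℂ) := ⟨fun θ => L θ, by fun_prop⟩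

/-- The functions on the sphere that are given by a polynomial of degree at most one. -/
def affineFun : Submodule ℂ C(Sph, ℂ) :=
  Submodule.span ℂ {1} ⊔ Submodule.span ℂ (Set.range linearFun)

theorem linearFun_mem (L : E3 →L[ℝ] ℂ) : linearFun L ∈ affineFun :=
  Submodule.mem_sup_right (Submodule.subset_span ⟨L, rfl⟩)

theorem one_mem_affineFun : (1 : C(Sph, ℂ)) ∈ affineFun :=
  Submodule.mem_sup_left (Submodule.subset_span rfl)

theorem affineFun_fg : affineFun.FG := by
  refine Submodule.FG.sup (Submodule.fg_span_singleton _) ?_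
  let c : Fin 3 → C(Sph, ℂ) := fun i => linearFun (Complex.ofRealCLM.comp (EuclideanSpace.proj i))
  have h : Submodule.span ℂ (Set.range linearFun) = Submodule.span ℂ (Set.range c) := by
    refine le_antisymm (Submodule.span_le.2 ?_) (Submodule.span_mono ?_)
    · rintro _ ⟨L, rfl⟩
      have : linearFun L = ∑ i, L (EuclideanSpace.basisFun (Fin 3) ℝ i) • c i := by
        ext θ
        have h1 := (EuclideanSpace.basisFun (Fin 3) ℝ).sum_repr (θ : E3)
        have h2 : L θ = ∑ i, ((θ : E3) i : ℂ) * L (EuclideanSpace.basisFun (Fin 3) ℝ i) := by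
          conv_lhs => rw [← h1]
          simp
        simp only [linearFun, ContinuousMap.coe_mk, h2, c]
        simp [mul_comm]
      rw [this]
      exact Submodule.sum_mem _ fun i _ => Submodule.smul_mem _ _ (Submodule.subset_span ⟨i, rfl⟩)
    · rintro _ ⟨i, rfl⟩
      exact ⟨_, rfl⟩
  rw [h]
  exact Submodule.fg_span (Set.finite_range c)

/-- The functions on the sphere given by a polynomial of degree at most `n`. -/
def polyFun (n : ℕ) : Submodule ℂ C(Sph, ℂ) := affineFun ^ n

theorem polyFun_succ (n : ℕ) : polyFun (n + 1) = polyFun n * affineFun := Submodule.pow_succ _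

theorem polyFun_mono : Monotone polyFun :=
  fun _ _ h => pow_le_pow_right' (Submodule.one_le.2 one_mem_affineFun) h

theorem finite_polyFun (n : ℕ) : Module.Finite ℂ (polyFun n) :=
  Module.Finite.iff_fg.2 (affineFun_fg.pow n)

/-- An induction principle for restrictions of polynomials. -/
theorem polyFun_induction {C : ℕ → C(Sph, ℂ) → Prop} (hconst : ∀ c : ℂ, C 0 (algebraMap ℂ _ c))
    (hadd : ∀ n g h, C n g → C n h → C n (g + h))
    (hmono : ∀ n g, C n g → C (n + 1) g)
    (hsmul : ∀ n g (c : ℂ), C n g → C n (c • g))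
    (hmul : ∀ n g L, g ∈ polyFun n → C n g → C (n + 1) (g * linearFun L)) {n : ℕ}
    {g : C(Sph, ℂ)} (hg : g ∈ polyFun n) : C n g := by
  induction n generalizing g with
  | zero =>
    rw [polyFun, Submodule.pow_zero] at hg
    obtain ⟨c, rfl⟩ := Submodule.mem_one.1 hg
    exact hconst c
  | succ n ih =>
    rw [polyFun_succ] at hg
    refine Submodule.mul_induction_on hg ?_ (fun x y hx hy => hadd _ x y hx hy)
    intro p hp q hq
    have h0 : C (n + 1) 0 := by
      have := hsmul _ _ 0 (hmono _ _ (ih hp))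
      rwa [zero_smul ℂ p] at this
    obtain ⟨q1, hq1, q2, hq2, rfl⟩ := Submodule.mem_sup.1 hq
    rw [mul_add]
    refine hadd _ _ _ ?_ ?_
    · obtain ⟨c, rfl⟩ := Submodule.mem_span_singleton.1 hq1
      rw [mul_smul_comm, mul_one]
      exact hsmul _ _ c (hmono _ _ (ih hp))
    · clear hq
      induction hq2 using Submodule.span_induction with
      | mem x hx =>
        obtain ⟨L, rfl⟩ := hx
        exact hmul _ _ L hp (ih hp)
      | zero => rw [mul_zero]; exact h0
      | add x y _ _ hx hy => rw [mul_add]; exact hadd _ _ _ hx hy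
      | smul c x _ hx => rw [mul_smul_comm]; exact hsmul _ _ _ hx

theorem polyFun_smooth {n : ℕ} {g : C(Sph, ℂ)} (hg : g ∈ polyFun n) : SphC ∞ g :=
  polyFun_induction (C := fun _ g => SphC ∞ g) (fun c => sphC_const ∞ c)
    (fun _ _ _ hg hh => hg.add hh) (fun _ _ h => h) (fun _ _ c hg => (sphC_const ∞ c).mul hg)
    (fun _ _ L _ hg => hg.mul (sphC_linear L)) hg

/-- Rotation fields do not raise the degree of polynomials. -/
theorem angDeriv_polyFun (a : Fin 3) {n : ℕ} {g : C(Sph, ℂ)} (hg : g ∈ polyFun n) :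
    ∃ h ∈ polyFun n, (h : Sph → ℂ) = angDeriv a g := by
  have key := polyFun_induction
    (C := fun n g => SphC 1 g ∧ ∃ h ∈ polyFun n, (h : Sph → ℂ) = angDeriv a g) (n := n) (g := g)
  refine (key ?_ ?_ ?_ ?_ ?_ hg).2
  · intro c
    refine ⟨sphC_const 1 c, 0, Submodule.zero_mem _, ?_⟩
    ext θ
    exact (angDeriv_const c a θ).symm
  · rintro n g h ⟨hg, g', hg', eg⟩ ⟨hh, h', hh', eh⟩
    refine ⟨hg.add hh, g' + h', Submodule.add_mem _ hg' hh', ?_⟩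
    ext θ
    rw [ContinuousMap.add_apply, eg, eh]
    exact (angDeriv_add le_rfl hg hh a θ).symm
  · rintro n g ⟨hg, g', hg', eg⟩
    exact ⟨hg, g', polyFun_mono n.le_succ hg', eg⟩
  · rintro n g c ⟨hg, g', hg', eg⟩
    refine ⟨(sphC_const 1 c).mul hg, c • g', Submodule.smul_mem _ _ hg', ?_⟩
    ext θ
    rw [ContinuousMap.smul_apply, eg]
    refine Eq.trans ?_ (angDeriv_mul le_rfl (sphC_const 1 c) hg a θ).symm
    rw [angDeriv_const]
    simp
  · rintro n g L hgn ⟨hg, g', hg', eg⟩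
    have hL : SphC 1 (linearFun L) := (sphC_linear L).of_le (by norm_num)
    refine ⟨hg.mul hL, g' * linearFun L + g * linearFun (L.comp (rotGen a)),
      Submodule.add_mem _ ?_ ?_, ?_⟩
    · rw [polyFun_succ]
      exact Submodule.mul_mem_mul hg' (linearFun_mem _)
    · rw [polyFun_succ]
      exact Submodule.mul_mem_mul hgn (linearFun_mem _)
    · ext θ
      rw [ContinuousMap.add_apply, ContinuousMap.mul_apply, ContinuousMap.mul_apply, eg]
      refine Eq.trans ?_ (angDeriv_mul le_rfl hg hL a θ).symm
      congr 2
      exact (angDeriv_linear L a θ).symm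

theorem laplaceBeltrami_polyFun {n : ℕ} {g : C(Sph, ℂ)} (hg : g ∈ polyFun n) :
    ∃ h ∈ polyFun n, (h : Sph → ℂ) = laplaceBeltrami g := by
  choose h1 h1m h1e using fun a => angDeriv_polyFun a hg
  choose h2 h2m h2e using fun a => angDeriv_polyFun a (h1m a)
  refine ⟨-∑ a, h2 a, Submodule.neg_mem _ (Submodule.sum_mem _ fun a _ => h2m a), ?_⟩
  ext θ
  rw [laplaceBeltrami_eq ((polyFun_smooth hg).of_le two_le_smooth)]
  simp [h2e, h1e]

/-- The algebra of restrictions of polynomials to the sphere. -/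
def polyAlg : StarSubalgebra ℂ C(Sph, ℂ) where
  carrier := {g | ∃ n, g ∈ polyFun n}
  mul_mem' := by
    rintro g h ⟨m, hg⟩ ⟨n, hh⟩
    refine ⟨m + (n + 1), ?_⟩
    rw [polyFun, Submodule.pow_add _ n.succ_ne_zero]
    exact Submodule.mul_mem_mul hg (polyFun_mono n.le_succ hh)
  add_mem' := by
    rintro g h ⟨m, hg⟩ ⟨n, hh⟩
    exact ⟨max m n, Submodule.add_mem _ (polyFun_mono (le_max_left m n) hg)
      (polyFun_mono (le_max_right m n) hh)⟩
  algebraMap_mem' c := ⟨0, by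
    rw [polyFun, Submodule.pow_zero]
    exact Submodule.mem_one.2 ⟨c, rfl⟩⟩
  star_mem' := by
    rintro g ⟨n, hg⟩
    refine ⟨n, polyFun_induction (C := fun n g => star g ∈ polyFun n) ?_ ?_ ?_ ?_ ?_ hg⟩
    · intro c
      rw [polyFun, Submodule.pow_zero]
      exact Submodule.mem_one.2 ⟨star c, rfl⟩
    · intro n g h hg hh
      rw [star_add]
      exact Submodule.add_mem _ hg hh
    · exact fun n g hg => polyFun_mono n.le_succ hg
    · intro n g c hg
      rw [star_smul]
      exact Submodule.smul_mem _ _ hg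
    · intro n g L _ hg
      have : star (linearFun L) = linearFun ((Complex.conjCLE : ℂ →L[ℝ] ℂ).comp L) := rfl
      rw [star_mul', this, polyFun_succ]
      exact Submodule.mul_mem_mul hg (linearFun_mem _)

theorem polyAlg_dense : polyAlg.topologicalClosure = ⊤ := by
  refine ContinuousMap.starSubalgebra_topologicalClosure_eq_top_of_separatesPoints _ ?_
  intro θ η hne
  have h1 : (θ : E3) ≠ η := fun h => hne (Subtype.ext h)
  obtain ⟨i, hi⟩ : ∃ i, (θ : E3) i ≠ (η : E3) i := by
    by_contra! h
    exact h1 (by ext i; exact h i)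
  refine ⟨_, ⟨linearFun (Complex.ofRealCLM.comp (EuclideanSpace.proj i)), ⟨1, ?_⟩, rfl⟩, ?_⟩
  · rw [polyFun, Submodule.pow_one]
    exact linearFun_mem _
  · simpa [linearFun] using hi

/-- `L²(Σ)` has a Hilbert basis of smooth eigenfunctions of the Laplace-Beltrami operator (the
spherical harmonics). -/
theorem exists_hilbertBasis_eigenfunctions :
    ∃ (ι : Type) (_ : Countable ι) (b : HilbertBasis ι ℂ L2) (φ : ι → C(Sph, ℂ)) (lam : ι → ℝ),
      (∀ j, SphC ∞ (φ j)) ∧ (∀ j θ, laplaceBeltrami (φ j) θ = lam j * φ j θ) ∧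
      ∀ j, b j = ContinuousMap.toLp 2 surf ℂ (φ j) := by
  let T : C(Sph, ℂ) →L[ℂ] L2 := ContinuousMap.toLp 2 surf ℂ
  have hTinj : Function.Injective T := ContinuousMap.toLp_injective _
  let J : smoothFun →ₗ[ℂ] L2 := (T : C(Sph, ℂ) →ₗ[ℂ] L2) ∘ₗ smoothFun.subtype
  have hJ : Function.Injective J := hTinj.comp Subtype.val_injective
  let e := LinearEquiv.ofInjective J hJ
  have he : ∀ g, ((e g : LinearMap.range J) : L2) = T g := fun g => rfl
  let A : LinearMap.range J →ₗ[ℂ] LinearMap.range J :=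
    (e : smoothFun →ₗ[ℂ] LinearMap.range J) ∘ₗ laplaceSmooth ∘ₗ
      (e.symm : LinearMap.range J →ₗ[ℂ] smoothFun)
  have hAe : ∀ g, A (e g) = e (laplaceSmooth g) := fun g => by simp [A]
  have hA : A.IsSymmetric := by
    intro x y
    obtain ⟨g, rfl⟩ := e.surjective x
    obtain ⟨h, rfl⟩ := e.surjective y
    rw [hAe, hAe, Submodule.coe_inner, Submodule.coe_inner]
    exact inner_toLp_laplaceBeltrami (g.2.of_le two_le_smooth) (h.2.of_le two_le_smooth) _ _
      (fun _ => rfl) fun _ => rfl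
  have hPS : ∀ n, polyFun n ≤ smoothFun := fun n g hg => polyFun_smooth hg
  let Y : ℕ → Submodule ℂ (LinearMap.range J) := fun n =>
    ((polyFun n).comap smoothFun.subtype).map (e : smoothFun →ₗ[ℂ] LinearMap.range J)
  have hYfin : ∀ n, FiniteDimensional ℂ (Y n) := by
    intro n
    have := finite_polyFun n
    have : Module.Finite ℂ ((polyFun n).comap smoothFun.subtype) :=
      Module.Finite.equiv (Submodule.comapSubtypeEquivOfLe (hPS n)).symm
    exact Module.Finite.map _ _
  have hYmono : Monotone Y := fun m n h =>
    Submodule.map_mono (Submodule.comap_mono (polyFun_mono h))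
  have hYinv : ∀ n, ∀ v ∈ Y n, A v ∈ Y n := by
    rintro n _ ⟨g, hg, rfl⟩
    obtain ⟨h, hh, eh⟩ := laplaceBeltrami_polyFun hg
    refine ⟨laplaceSmooth g, ?_, (hAe g).symm⟩
    have : ((laplaceSmooth g : smoothFun) : C(Sph, ℂ)) = h := by
      ext θ; exact (congrFun eh θ).symm
    show ((laplaceSmooth g : smoothFun) : C(Sph, ℂ)) ∈ polyFun n
    rw [this]
    exact hh
  obtain ⟨ι, hι, v, lam, hv, hAv, hspan⟩ := exists_orthonormal_eigenvectors hA Y hYmono hYinv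
  have hv' : Orthonormal ℂ fun j => ((v j : LinearMap.range J) : L2) :=
    hv.comp_linearIsometry (LinearMap.range J).subtypeₗᵢ
  have hdense : ⊤ ≤ (Submodule.span ℂ
      (Set.range fun j => ((v j : LinearMap.range J) : L2))).topologicalClosure := by
    set K := Submodule.span ℂ (Set.range fun j => ((v j : LinearMap.range J) : L2)) with hK
    have h1 : ∀ g ∈ polyAlg, T g ∈ K := by
      rintro g ⟨n, hg⟩
      have h2 : e ⟨g, hPS n hg⟩ ∈ Submodule.span ℂ (Set.range v) := hspan n ⟨_, hg, rfl⟩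
      have h3 := Submodule.mem_map_of_mem (f := (LinearMap.range J).subtype) h2
      rw [Submodule.map_span, ← Set.range_comp] at h3
      exact h3
    have h4 : ∀ g, T g ∈ K.topologicalClosure := by
      intro g
      have hg : g ∈ polyAlg.topologicalClosure := by rw [polyAlg_dense]; trivial
      exact map_mem_closure T.continuous hg h1
    intro x _
    have h5 : DenseRange T := ContinuousMap.toLp_denseRange ℂ _ _ (by simp)
    have h6 : closure (Set.range T) ⊆ K.topologicalClosure :=
      closure_minimal (Set.range_subset_iff.2 h4) K.isClosed_topologicalClosure
    exact h6 (h5 x)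
  refine ⟨ι, hι, HilbertBasis.mk hv' hdense, fun j => (e.symm (v j) : smoothFun), lam,
    fun j => (e.symm (v j)).2, ?_, ?_⟩
  · intro j θ
    have h1 : laplaceSmooth (e.symm (v j)) = (lam j : ℂ) • e.symm (v j) := by
      apply e.injective
      rw [← hAe, map_smul, e.apply_symm_apply, hAv]
    exact congrArg (fun g : smoothFun => (g : C(Sph, ℂ)) θ) h1
  · intro j
    rw [HilbertBasis.coe_mk]
    have := he (e.symm (v j))
    rw [e.apply_symm_apply] at this
    exact this

end Harmonics

/-! ### Operators diagonal in a Hilbert basis -/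

section Diagonal

open Filter Topology

variable {ι : Type} {E : Type} [NormedAddCommGroup E] [InnerProductSpace ℂ E]
  (b : HilbertBasis ι ℂ E)

theorem norm_circle_mul (c : Circle) (z : ℂ) : ‖(c : ℂ) * z‖ = ‖z‖ := by
  rw [norm_mul, Circle.norm_coe, one_mul]

theorem memℓp_circle_mul (c : ι → Circle) (x : lp (fun _ : ι => ℂ) 2) :
    Memℓp (fun j => (c j : ℂ) * x j) 2 := by
  have h := lp.memℓp x
  rw [memℓp_gen_iff (by norm_num)] at h ⊢
  exact h.congr fun j => by rw [norm_circle_mul]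

/-- The unitary operator that multiplies the coefficients with respect to a Hilbert basis by
given numbers of modulus one. -/
def diagIsom (c : ι → Circle) : E →ₗᵢ[ℂ] E where
  toFun f := b.repr.symm ⟨fun j => (c j : ℂ) * b.repr f j, memℓp_circle_mul c (b.repr f)⟩
  map_add' f g := by
    rw [← map_add]
    congr 1
    ext j
    exact congrArg (_ * ·) (congrFun (congrArg Subtype.val (map_add b.repr f g)) j) |>.trans
      (mul_add _ _ _)
  map_smul' z f := by
    rw [RingHom.id_apply, ← map_smul]
    congr 1
    ext j
    simp [mul_left_comm]
  norm_map' f := by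
    have h : ∀ x y : lp (fun _ : ι => ℂ) 2, (∀ j, ‖x j‖ = ‖y j‖) → ‖x‖ = ‖y‖ := by
      intro x y hxy
      rw [lp.norm_eq_tsum_rpow (by norm_num), lp.norm_eq_tsum_rpow (by norm_num)]
      simp only [hxy]
    exact (b.repr.symm.norm_map _).trans ((h _ (b.repr f) fun j => norm_circle_mul _ _).trans
      (b.repr.norm_map f))

theorem repr_diagIsom (c : ι → Circle) (f : E) (j : ι) :
    b.repr (diagIsom b c f) j = c j * b.repr f j := by
  show b.repr (b.repr.symm _) j = _
  rw [LinearIsometryEquiv.apply_symm_apply]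

theorem inner_diagIsom (c : ι → Circle) (f : E) (j : ι) :
    inner ℂ (b j) (diagIsom b c f) = c j * inner ℂ (b j) f := by
  rw [← b.repr_apply_apply, ← b.repr_apply_apply, repr_diagIsom]

theorem HilbertBasis.ext_inner {f g : E} (h : ∀ j, inner ℂ (b j) f = inner ℂ (b j) g) : f = g := by
  apply b.repr.injective
  ext j
  rw [b.repr_apply_apply, b.repr_apply_apply, h]

theorem diagIsom_mul (c d : ι → Circle) (f : E) :
    diagIsom b (c * d) f = diagIsom b c (diagIsom b d f) := by
  refine HilbertBasis.ext_inner b fun j => ?_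
  simp [inner_diagIsom, mul_assoc]

theorem diagIsom_one (f : E) : diagIsom b 1 f = f := by
  refine HilbertBasis.ext_inner b fun j => ?_
  simp [inner_diagIsom]

theorem diagIsom_basis (c : ι → Circle) (j : ι) : diagIsom b c (b j) = (c j : ℂ) • b j := by
  refine HilbertBasis.ext_inner b fun i => ?_
  classical
  rw [inner_diagIsom, inner_smul_right, orthonormal_iff_ite.1 b.orthonormal]
  split_ifs with h
  · rw [h]
  · simp

theorem continuous_diagIsom {X : Type} [TopologicalSpace X] (c : X → ι → Circle)
    (hc : ∀ j, Continuous fun x => c x j) (f : E) : Continuous fun x => diagIsom b (c x) f := by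
  refine continuous_of_uniform_approx_of_continuous fun u hu => ?_
  obtain ⟨ε, hε, hεu⟩ := Metric.mem_uniformity_dist.1 hu
  have h1 := Metric.tendsto_nhds.1 (b.hasSum_repr f) ε hε
  obtain ⟨s, hs⟩ := h1.exists
  refine ⟨fun x => ∑ j ∈ s, (b.repr f j * (c x j : ℂ)) • b j, ?_, fun x => ?_⟩
  · exact continuous_finsetSum _ fun j _ => by
      have := hc j
      fun_prop
  · apply hεu
    have h2 : ∑ j ∈ s, (b.repr f j * (c x j : ℂ)) • b j =
        diagIsom b (c x) (∑ j ∈ s, b.repr f j • b j) := by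
      rw [map_sum]
      refine Finset.sum_congr rfl fun j _ => ?_
      rw [map_smul, diagIsom_basis, smul_smul]
    show dist (diagIsom b (c x) f) (∑ j ∈ s, (b.repr f j * (c x j : ℂ)) • b j) < ε
    rw [h2, (diagIsom b (c x)).isometry.dist_eq, dist_comm]
    exact hs

/-- The finite rank operator with the real eigenvalues `w j`, `j ∈ s`, on a Hilbert basis. -/
def diagFin (w : ι → ℝ) (s : Finset ι) : E →L[ℂ] E :=
  ∑ j ∈ s, (w j : ℂ) • (innerSL ℂ (b j)).smulRight (b j)

theorem diagFin_apply (w : ι → ℝ) (s : Finset ι) (f : E) :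
    diagFin b w s f = ∑ j ∈ s, ((w j : ℂ) * inner ℂ (b j) f) • b j := by
  simp [diagFin, mul_smul]

open scoped Classical in
theorem inner_diagFin (w : ι → ℝ) (s : Finset ι) (f : E) (j : ι) :
    inner ℂ (b j) (diagFin b w s f) = if j ∈ s then w j * inner ℂ (b j) f else 0 := by
  rw [diagFin_apply, inner_sum]
  simp only [inner_smul_right, orthonormal_iff_ite.1 b.orthonormal]
  simp

theorem inner_diagFin_left (w : ι → ℝ) (s : Finset ι) (f g : E) :
    inner ℂ (diagFin b w s f) g = inner ℂ f (diagFin b w s g) := by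
  rw [diagFin_apply, diagFin_apply, inner_sum, sum_inner]
  refine Finset.sum_congr rfl fun j _ => ?_
  rw [inner_smul_left, inner_smul_right, map_mul, inner_conj_symm, Complex.conj_ofReal]
  ring

theorem diagFin_diagFin (w w' : ι → ℝ) (s : Finset ι) (f : E) :
    diagFin b w s (diagFin b w' s f) = diagFin b (fun j => w j * w' j) s f := by
  classical
  refine HilbertBasis.ext_inner b fun j => ?_
  simp only [inner_diagFin]
  split_ifs <;> simp [mul_assoc]

theorem diagFin_diagIsom (w : ι → ℝ) (s : Finset ι) (c : ι → Circle) (f : E) :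
    diagFin b w s (diagIsom b c f) = diagIsom b c (diagFin b w s f) := by
  classical
  refine HilbertBasis.ext_inner b fun j => ?_
  simp only [inner_diagFin, inner_diagIsom]
  split_ifs
  · ring
  · simp

theorem norm_diagFin_one_le (s : Finset ι) : ‖diagFin b 1 s‖ ≤ 1 := by
  refine ContinuousLinearMap.opNorm_le_bound _ zero_le_one fun f => ?_
  have h1 : ‖diagFin b 1 s f‖ ^ 2 ≤ ‖diagFin b 1 s f‖ * ‖f‖ := by
    have h2 : inner ℂ (diagFin b 1 s f) (diagFin b 1 s f) = inner ℂ (diagFin b 1 s f) f := by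
      rw [inner_diagFin_left b 1 s f (diagFin b 1 s f), diagFin_diagFin, inner_diagFin_left]
      simp only [Pi.one_apply, mul_one]
      rfl
    rw [← inner_self_eq_norm_sq (𝕜 := ℂ), h2]
    exact (RCLike.re_le_norm _).trans (norm_inner_le_norm _ _)
  rcases (norm_nonneg (diagFin b 1 s f)).eq_or_lt with h | h
  · rw [← h]; positivity
  · rw [one_mul]
    exact le_of_mul_le_mul_left (by rwa [← sq]) h

theorem tendsto_diagFin_one (f : E) :
    Tendsto (fun s : Finset ι => diagFin b 1 s f) atTop (𝓝 f) := by
  refine (b.hasSum_repr f).congr fun s => ?_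
  rw [diagFin_apply]
  simp [b.repr_apply_apply]

end Diagonal

/-! ### Multiplication operators -/

section Multiplication

/-- Multiplication of square integrable functions by a continuous function. -/
def mulOp : C(Sph, ℂ) →L[ℂ] L2 →L[ℂ] L2 :=
  ((ContinuousLinearMap.mul ℂ ℂ).holderL surf ⊤ 2 2).comp (ContinuousMap.toLp ⊤ surf ℂ)

theorem coeFn_mulOp (m : C(Sph, ℂ)) (f : L2) : mulOp m f =ᵐ[surf] fun θ => m θ * f θ := by
  have h1 := ContinuousLinearMap.coeFn_holder (μ := surf) (r := 2) (ContinuousLinearMap.mul ℂ ℂ)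
    (ContinuousMap.toLp ⊤ surf ℂ m) f
  have h2 := ContinuousMap.coeFn_toLp (p := ⊤) surf (𝕜 := ℂ) m
  refine h1.trans ?_
  filter_upwards [h2] with θ h
  rw [h]
  rfl

theorem mulL2_eq (m : C(Sph, ℂ)) (g : Sph → ℂ) (hg : ∀ θ, g θ = m θ) (f : L2) :
    mulL2 g f = mulOp m f := by
  have h1 := coeFn_mulOp m f
  have h2 : MemLp (fun θ => g θ * f θ) 2 surf := by
    simp only [hg]
    exact (Lp.memLp (mulOp m f)).ae_eq h1
  rw [mulL2, dif_pos h2]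
  refine Lp.ext (h2.coeFn_toLp.trans ?_)
  simp only [hg]
  exact h1.symm

theorem norm_mulOp_le {m : C(Sph, ℂ)} {c : ℝ} (hm : ∀ θ, ‖m θ‖ ≤ c) (f : L2) :
    ‖mulOp m f‖ ≤ c * ‖f‖ := by
  refine Lp.norm_le_mul_norm_of_ae_le_mul ?_
  filter_upwards [coeFn_mulOp m f] with θ h
  rw [h, norm_mul]
  exact mul_le_mul_of_nonneg_right (hm θ) (norm_nonneg _)

theorem mulOp_mul (m n : C(Sph, ℂ)) (f : L2) : mulOp (m * n) f = mulOp m (mulOp n f) := by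
  refine Lp.ext ?_
  filter_upwards [coeFn_mulOp (m * n) f, coeFn_mulOp m (mulOp n f), coeFn_mulOp n f]
    with θ h1 h2 h3
  rw [h1, h2, h3, ContinuousMap.mul_apply, mul_assoc]

theorem mulOp_toLp (m g : C(Sph, ℂ)) :
    mulOp m (ContinuousMap.toLp 2 surf ℂ g) = ContinuousMap.toLp 2 surf ℂ (m * g) := by
  refine Lp.ext ?_
  filter_upwards [coeFn_mulOp m (ContinuousMap.toLp 2 surf ℂ g),
    ContinuousMap.coeFn_toLp (p := 2) surf (𝕜 := ℂ) g,
    ContinuousMap.coeFn_toLp (p := 2) surf (𝕜 := ℂ) (m * g)] with θ h1 h2 h3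
  rw [h1, h2, h3, ContinuousMap.mul_apply]

theorem inner_mulOp_left {m : C(Sph, ℂ)} (hm : ∀ θ, (starRingEnd ℂ) (m θ) = m θ) (f g : L2) :
    inner ℂ (mulOp m f) g = inner ℂ f (mulOp m g) := by
  rw [L2.inner_def, L2.inner_def]
  refine integral_congr_ae ?_
  filter_upwards [coeFn_mulOp m f, coeFn_mulOp m g] with θ h1 h2
  simp only [h1, h2, RCLike.inner_apply, map_mul, hm]
  ring

end Multiplication

/-! ### The free evolution in the basis of spherical harmonics -/

section Spectral

/-- A Hilbert basis of `L²(Σ)` of smooth eigenfunctions of the Laplace-Beltrami operator. -/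
structure HarmonicBasis (ι : Type) where
  /-- the basis -/
  basis : HilbertBasis ι ℂ L2
  /-- the eigenfunctions as functions on the sphere -/
  fn : ι → C(Sph, ℂ)
  /-- the eigenvalues -/
  ev : ι → ℝ
  smooth : ∀ j, SphC ∞ (fn j)
  eigen : ∀ j θ, laplaceBeltrami (fn j) θ = ev j * fn j θ
  basis_eq : ∀ j, basis j = ContinuousMap.toLp 2 surf ℂ (fn j)

variable {ι : Type} (h : HarmonicBasis ι)

theorem HarmonicBasis.mem_eigenspaceB (j : ι) : h.basis j ∈ eigenspaceB (h.ev j) := by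
  refine Submodule.le_topologicalClosure _ (Submodule.subset_span
    ⟨h.fn j, (h.smooth j).contMDiff, h.eigen j, ?_⟩)
  rw [h.basis_eq]
  exact ContinuousMap.coeFn_toLp surf _

/-- Eigenfunctions for different eigenvalues are orthogonal, by the symmetry of the operator. -/
theorem HarmonicBasis.inner_eigenspaceB {ev : ℝ} {j : ι} (hj : h.ev j ≠ ev) {f : L2}
    (hf : f ∈ eigenspaceB ev) : inner ℂ (h.basis j) f = 0 := by
  have h1 : eigenspaceB ev ≤ (Submodule.span ℂ {h.basis j})ᗮ := by
    refine Submodule.topologicalClosure_minimal _ (Submodule.span_le.2 ?_)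
      (Submodule.isClosed_orthogonal _)
    rintro f ⟨g, hg, hgev, hfg⟩
    rw [SetLike.mem_coe, Submodule.mem_orthogonal_singleton_iff_inner_right]
    have hgS : SphC ∞ g := SphC.of_contMDiff hg
    let gc : C(Sph, ℂ) := ⟨g, hgS.continuous⟩
    have hf : f = ContinuousMap.toLp 2 surf ℂ gc :=
      Lp.ext (hfg.trans (ContinuousMap.coeFn_toLp (p := 2) surf (𝕜 := ℂ) gc).symm)
    have h2 := inner_toLp_laplaceBeltrami ((h.smooth j).of_le two_le_smooth)
      (show SphC 2 gc from hgS.of_le two_le_smooth) ((h.ev j : ℂ) • h.fn j) ((ev : ℂ) • gc)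
      (fun θ => (h.eigen j θ).symm) (fun θ => (hgev θ).symm)
    rw [map_smul, map_smul, inner_smul_left, inner_smul_right, Complex.conj_ofReal, ← h.basis_eq,
      ← hf] at h2
    have h3 : ((h.ev j : ℂ) - ev) * inner ℂ (h.basis j) f = 0 := by
      rw [sub_mul, h2, sub_self]
    refine (mul_eq_zero.1 h3).resolve_left (sub_ne_zero.2 ?_)
    exact_mod_cast hj
  exact Submodule.mem_orthogonal_singleton_iff_inner_right.1 (h1 hf)

open scoped Classical in
theorem HarmonicBasis.inner_starProjection (ev : ℝ) (j : ι) (f : L2) :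
    inner ℂ (h.basis j) ((eigenspaceB ev).starProjection f) =
      if h.ev j = ev then inner ℂ (h.basis j) f else 0 := by
  rw [← Submodule.inner_starProjection_left_eq_right]
  split_ifs with hj
  · rw [Submodule.starProjection_eq_self_iff.2 (hj ▸ h.mem_eigenspaceB j)]
  · rw [Submodule.inner_starProjection_left_eq_right]
    exact h.inner_eigenspaceB hj (Submodule.starProjection_apply_mem _ _)

/-- The phase factors of `exp ((i k)⁻¹ r B)`. -/
def HarmonicBasis.phase (k r : ℝ) (j : ι) : Circle := Circle.exp (-(r * h.ev j / k))

theorem HarmonicBasis.coe_phase (k r : ℝ) (j : ι) :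
    (h.phase k r j : ℂ) = Complex.exp ((Complex.I * (k : ℂ))⁻¹ * (r : ℂ) * (h.ev j : ℂ)) := by
  rw [HarmonicBasis.phase, Circle.coe_exp, mul_inv, Complex.inv_I]
  congr 1
  push_cast
  ring

/-- The spectral definition of `exp ((i k)⁻¹ r B)` amounts to the multiplication of the
coefficients with respect to the spherical harmonics by phase factors. -/
theorem HarmonicBasis.expB_eq (k r : ℝ) (f : L2) :
    expB ((Complex.I * (k : ℂ))⁻¹ * (r : ℂ)) f = diagIsom h.basis (h.phase k r) f := by
  -- group the expansion in spherical harmonics by eigenvalues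
  refine HasSum.tsum_eq ?_
  have h1 := h.basis.hasSum_repr (diagIsom h.basis (h.phase k r) f)
  have h2 := (Equiv.sigmaFiberEquiv h.ev).hasSum_iff.2 h1
  refine h2.sigma fun ev => ?_
  have h3 := (h.basis.hasSum_repr ((eigenspaceB ev).starProjection f)).const_smul
    (Complex.exp ((Complex.I * (k : ℂ))⁻¹ * (r : ℂ) * (ev : ℂ)))
  have h4 := (hasSum_subtype_iff_of_support_subset (s := {j | h.ev j = ev}) ?_).2 h3
  · refine HasSum.congr_fun h4 fun x : {j // h.ev j = ev} => ?_
    obtain ⟨j, hj⟩ := x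
    simp only [Function.comp, Equiv.sigmaFiberEquiv_apply, HilbertBasis.repr_apply_apply,
      inner_diagIsom, h.inner_starProjection, h.coe_phase, hj, mul_smul, if_true]
  · intro j hj
    by_contra hne
    refine hj ?_
    have hne' : ¬ h.ev j = ev := hne
    simp only [HilbertBasis.repr_apply_apply, h.inner_starProjection, if_neg hne', zero_smul,
      smul_zero]

/-- `exp ((i k)⁻¹ r B)` as an operator. -/
def HarmonicBasis.evol (k r : ℝ) : L2 →L[ℂ] L2 :=
  (diagIsom h.basis (h.phase k r)).toContinuousLinearMap

theorem HarmonicBasis.U0_eq (k : ℝ) {s τ : ℝ} (hs : s ≠ 0) (hτ : τ ≠ 0) (f : L2) :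
    U0 k s τ f = h.evol k (s⁻¹ - τ⁻¹) f := by
  rw [U0, h.expB_eq]
  have : (τ - s) / (τ * s) = s⁻¹ - τ⁻¹ := by field_simp
  rw [this]
  rfl

theorem HarmonicBasis.norm_evol (k r : ℝ) (f : L2) : ‖h.evol k r f‖ = ‖f‖ :=
  (diagIsom h.basis (h.phase k r)).norm_map f

theorem HarmonicBasis.evol_add (k r s : ℝ) (f : L2) :
    h.evol k (r + s) f = h.evol k r (h.evol k s f) := by
  have : h.phase k (r + s) = h.phase k r * h.phase k s := by
    ext1 j
    rw [Pi.mul_apply, HarmonicBasis.phase, HarmonicBasis.phase, HarmonicBasis.phase,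
      ← Circle.exp_add]
    congr 1
    ring
  show diagIsom h.basis (h.phase k (r + s)) f = _
  rw [this, diagIsom_mul]
  rfl

theorem HarmonicBasis.evol_zero (k : ℝ) (f : L2) : h.evol k 0 f = f := by
  have : h.phase k 0 = 1 := by
    ext1 j
    simp [HarmonicBasis.phase]
  show diagIsom h.basis (h.phase k 0) f = _
  rw [this, diagIsom_one]

theorem HarmonicBasis.evol_neg_evol (k r : ℝ) (f : L2) : h.evol k (-r) (h.evol k r f) = f := by
  rw [← h.evol_add, neg_add_cancel, h.evol_zero]

theorem HarmonicBasis.evol_evol_neg (k r : ℝ) (f : L2) : h.evol k r (h.evol k (-r) f) = f := by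
  rw [← h.evol_add, add_neg_cancel, h.evol_zero]

theorem HarmonicBasis.inner_evol (k r : ℝ) (f g : L2) :
    inner ℂ (h.evol k r f) g = inner ℂ f (h.evol k (-r) g) := by
  conv_lhs => rw [← h.evol_evol_neg k r g]
  exact (diagIsom h.basis (h.phase k r)).inner_map_map _ _

theorem HarmonicBasis.continuous_evol (k : ℝ) (f : L2) : Continuous fun r => h.evol k r f := by
  refine continuous_diagIsom h.basis (fun r => h.phase k r) (fun j => ?_) f
  unfold HarmonicBasis.phase
  fun_prop

end Spectral

/-! ### Linear evolution equations and their Galerkin approximation -/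

section Dyson

open Filter Topology

variable {E : Type} [NormedAddCommGroup E] [NormedSpace ℂ E] [NormedSpace ℝ E]

omit [NormedSpace ℝ E] in
/-- A uniformly bounded strongly continuous family of operators maps continuous curves to
continuous curves. -/
theorem continuous_clm_apply_of_bounded {G : ℝ → E →L[ℂ] E} {M : ℝ}
    (hM : ∀ s, ‖G s‖ ≤ M) (hG : ∀ v, Continuous fun s => G s v) {v : ℝ → E}
    (hv : Continuous v) : Continuous fun s => G s (v s) := by
  rw [continuous_iff_continuousAt]
  intro t
  have h1 : Tendsto (fun s => G s (v s - v t)) (𝓝 t) (𝓝 0) := by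
    have h2 : Tendsto (fun s => M * ‖v s - v t‖) (𝓝 t) (𝓝 0) := by
      have : Continuous fun s => M * ‖v s - v t‖ := by fun_prop
      simpa using this.tendsto t
    exact squeeze_zero_norm (fun s => (G s).le_of_opNorm_le (hM s) _) h2
  have h3 := h1.add ((hG (v t)).tendsto t)
  rw [zero_add] at h3
  refine h3.congr fun s => ?_
  rw [← map_add, sub_add_cancel]

/-- The terms of the Dyson series for `z' = G z`, `z(1) = f`. -/
def dysonTerm (G : ℝ → E →L[ℂ] E) (f : E) : ℕ → ℝ → E
  | 0, _ => f
  | n + 1, τ => ∫ s in (1 : ℝ)..τ, G s (dysonTerm G f n s)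

/-- The sum of the Dyson series, the solution of `z' = G z`, `z(1) = f`. -/
def dyson (G : ℝ → E →L[ℂ] E) (f : E) (τ : ℝ) : E := ∑' n, dysonTerm G f n τ

variable {G : ℝ → E →L[ℂ] E} {M : ℝ}

theorem continuous_dysonTerm (hM : ∀ s, ‖G s‖ ≤ M) (hG : ∀ v, Continuous fun s => G s v)
    (f : E) (n : ℕ) : Continuous (dysonTerm G f n) := by
  induction n with
  | zero => exact continuous_const
  | succ n ih =>
    exact intervalIntegral.continuous_primitive
      (fun a b => (continuous_clm_apply_of_bounded hM hG ih).intervalIntegrable a b) 1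

theorem norm_dysonTerm_le (hM : ∀ s, ‖G s‖ ≤ M) (f : E) (n : ℕ) (τ : ℝ) :
    ‖dysonTerm G f n τ‖ ≤ (M * |τ - 1|) ^ n / n.factorial * ‖f‖ := by
  have hM0 : 0 ≤ M := (norm_nonneg _).trans (hM 0)
  induction n generalizing τ with
  | zero => simp [dysonTerm]
  | succ n ih =>
    have hb : ∀ s, ‖G s (dysonTerm G f n s)‖ ≤
        M ^ (n + 1) / n.factorial * ‖f‖ * |s - 1| ^ n := by
      intro s
      refine ((G s).le_of_opNorm_le (hM s) _).trans
        ((mul_le_mul_of_nonneg_left (ih s) hM0).trans_eq ?_)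
      rw [mul_pow]; ring
    have hint : ∀ c d : ℝ, IntervalIntegrable
        (fun s => M ^ (n + 1) / n.factorial * ‖f‖ * |s - 1| ^ n) volume c d := fun c d =>
      (by fun_prop : Continuous fun s : ℝ =>
        M ^ (n + 1) / n.factorial * ‖f‖ * |s - 1| ^ n).intervalIntegrable c d
    have e1 : ((n + 1).factorial : ℝ) = (n + 1) * n.factorial := by
      rw [Nat.factorial_succ]; push_cast; ring
    have e2 : (n.factorial : ℝ) ≠ 0 := by positivity
    have e3 : (n + 1 : ℝ) ≠ 0 := by positivity
    have key : |∫ s in (1 : ℝ)..τ, M ^ (n + 1) / n.factorial * ‖f‖ * |s - 1| ^ n| =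
        (M * |τ - 1|) ^ (n + 1) / (n + 1).factorial * ‖f‖ := by
      rw [intervalIntegral.integral_const_mul, abs_mul,
        abs_of_nonneg (by positivity : 0 ≤ M ^ (n + 1) / n.factorial * ‖f‖)]
      have : |∫ s in (1 : ℝ)..τ, |s - 1| ^ n| = |τ - 1| ^ (n + 1) / (n + 1) := by
        have h1 := integral_pow_abs_sub_uIoc (a := (1 : ℝ)) (b := τ) n
        have h2 := intervalIntegral.norm_integral_eq_norm_integral_uIoc (a := (1 : ℝ)) (b := τ)
          (μ := volume) fun s : ℝ => |s - 1| ^ n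
        rw [h1, Real.norm_eq_abs, Real.norm_eq_abs] at h2
        rw [h2, abs_of_nonneg (by positivity)]
      rw [this, mul_pow, e1]
      field_simp
    rw [dysonTerm, ← key]
    exact intervalIntegral.norm_integral_le_abs_of_norm_le (Eventually.of_forall hb) (hint _ _)

theorem summable_dyson_bound (x c : ℝ) :
    Summable fun n : ℕ => x ^ n / n.factorial * c :=
  (Real.summable_pow_div_factorial x).mul_right c

variable [CompleteSpace E]

theorem summable_dysonTerm (hM : ∀ s, ‖G s‖ ≤ M) (f : E) (τ : ℝ) :
    Summable fun n => dysonTerm G f n τ :=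
  Summable.of_norm_bounded (summable_dyson_bound _ _) fun n => norm_dysonTerm_le hM f n τ

omit [CompleteSpace E] in
theorem dyson_one (f : E) : dyson G f 1 = f := by
  rw [dyson, tsum_eq_single 0]
  · rfl
  · rintro (_ | n) hn
    · exact absurd rfl hn
    · simp [dysonTerm]

theorem hasDerivAt_dysonTerm_succ (hM : ∀ s, ‖G s‖ ≤ M) (hG : ∀ v, Continuous fun s => G s v)
    (f : E) (n : ℕ) (τ : ℝ) :
    HasDerivAt (dysonTerm G f (n + 1)) (G τ (dysonTerm G f n τ)) τ :=
  ((continuous_clm_apply_of_bounded hM hG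
    (continuous_dysonTerm hM hG f n)).integral_hasStrictDerivAt 1 τ).hasDerivAt

theorem hasDerivAt_dyson (hM : ∀ s, ‖G s‖ ≤ M) (hG : ∀ v, Continuous fun s => G s v) (f : E)
    (τ : ℝ) : HasDerivAt (dyson G f) (G τ (dyson G f τ)) τ := by
  have hM0 : 0 ≤ M := (norm_nonneg _).trans (hM 0)
  set R := |τ - 1| + 1 with hR
  let g' : ℕ → ℝ → E := fun n y => match n with
    | 0 => 0
    | n + 1 => G y (dysonTerm G f n y)
  let u : ℕ → ℝ := fun n => match n with
    | 0 => 0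
    | n + 1 => M * ((M * R) ^ n / n.factorial * ‖f‖)
  have hu : Summable u := by
    rw [← summable_nat_add_iff 1]
    exact (summable_dyson_bound _ _).mul_left M
  have hτ : τ ∈ Metric.ball (1 : ℝ) R := by
    rw [Metric.mem_ball, Real.dist_eq]; linarith
  have h := hasDerivAt_tsum_of_isPreconnected (g := dysonTerm G f) (g' := g') hu
    Metric.isOpen_ball (convex_ball (1 : ℝ) R).isPreconnected ?_ ?_ hτ
    (summable_dysonTerm hM f τ) hτ
  · have h1 : HasSum (fun n => G τ (dysonTerm G f n τ)) (G τ (dyson G f τ)) :=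
      (summable_dysonTerm hM f τ).hasSum.mapL (G τ)
    have h2 : HasSum (fun n => g' n τ) (G τ (dyson G f τ)) := by
      refine (hasSum_nat_add_iff' (f := fun n => g' n τ) 1).1 ?_
      rw [Finset.sum_range_one]
      show HasSum (fun n => G τ (dysonTerm G f n τ)) (G τ (dyson G f τ) - 0)
      rwa [sub_zero]
    rw [h2.tsum_eq] at h
    exact h
  · rintro (_ | n) y _
    · exact hasDerivAt_const y f
    · exact hasDerivAt_dysonTerm_succ hM hG f n y
  · rintro (_ | n) y hy
    · simp [g', u]
    · have h1 : |y - 1| ≤ R := by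
        rw [Metric.mem_ball, Real.dist_eq] at hy; exact hy.le
      have h2 : ‖dysonTerm G f n y‖ ≤ (M * R) ^ n / n.factorial * ‖f‖ :=
        (norm_dysonTerm_le hM f n y).trans (by gcongr)
      exact ((G y).le_of_opNorm_le (hM y) _).trans (mul_le_mul_of_nonneg_left h2 hM0)

omit [CompleteSpace E] in
theorem dysonTerm_sub (hM : ∀ s, ‖G s‖ ≤ M) (hG : ∀ v, Continuous fun s => G s v) (f g : E)
    (n : ℕ) (τ : ℝ) : dysonTerm G (f - g) n τ = dysonTerm G f n τ - dysonTerm G g n τ := by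
  induction n generalizing τ with
  | zero => rfl
  | succ n ih =>
    simp only [dysonTerm, ih, map_sub]
    exact intervalIntegral.integral_sub
      ((continuous_clm_apply_of_bounded hM hG
        (continuous_dysonTerm hM hG f n)).intervalIntegrable _ _)
      ((continuous_clm_apply_of_bounded hM hG
        (continuous_dysonTerm hM hG g n)).intervalIntegrable _ _)

theorem dyson_sub (hM : ∀ s, ‖G s‖ ≤ M) (hG : ∀ v, Continuous fun s => G s v) (f g : E)
    (τ : ℝ) : dyson G (f - g) τ = dyson G f τ - dyson G g τ := by
  simp only [dyson, dysonTerm_sub hM hG]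
  exact (summable_dysonTerm hM f τ).tsum_sub (summable_dysonTerm hM g τ)

/-- If `P` is a projection fixing the initial value then so is the solution of `z' = P G z`. -/
theorem clm_dyson_eq_self (hM : ∀ s, ‖G s‖ ≤ M) (hG : ∀ v, Continuous fun s => G s v)
    {P : E →L[ℂ] E} (hP : ∀ s v, P (G s v) = G s v) {f : E} (hf : P f = f) (τ : ℝ) :
    P (dyson G f τ) = dyson G f τ := by
  have h1 : ∀ n, P (dysonTerm G f n τ) = dysonTerm G f n τ := by
    rintro (_ | n)
    · exact hf
    · simp only [dysonTerm]
      rw [← ContinuousLinearMap.intervalIntegral_comp_comm]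
      · simp only [hP]
      · exact (continuous_clm_apply_of_bounded hM hG
          (continuous_dysonTerm hM hG f n)).intervalIntegrable _ _
  rw [dyson, P.map_tsum (summable_dysonTerm hM f τ)]
  simp only [h1]

/-- Convergence of the Galerkin approximations. -/
theorem tendsto_dyson_galerkin {α : Type} {l : Filter α} [l.IsCountablyGenerated]
    (hM : ∀ s, ‖G s‖ ≤ M) (hG : ∀ v, Continuous fun s => G s v) {P : α → E →L[ℂ] E}
    (hP1 : ∀ a, ‖P a‖ ≤ 1) (hP : ∀ v, Tendsto (fun a => P a v) l (𝓝 v)) (f : E) (τ : ℝ) :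
    Tendsto (fun a => dyson (fun s => (P a).comp (G s)) f τ) l (𝓝 (dyson G f τ)) := by
  have hM' : ∀ a s, ‖(P a).comp (G s)‖ ≤ M := fun a s =>
    ((P a).opNorm_comp_le (G s)).trans
      ((mul_le_mul (hP1 a) (hM s) (norm_nonneg _) zero_le_one).trans_eq (one_mul M))
  have hG' : ∀ a v, Continuous fun s => (P a).comp (G s) v := fun a v =>
    (P a).continuous.comp (hG v)
  have hM0 : 0 ≤ M := (norm_nonneg _).trans (hM 0)
  have hPv : ∀ (w : α → E) (v : E), Tendsto w l (𝓝 v) → Tendsto (fun a => P a (w a)) l (𝓝 v) := by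
    intro w v hw
    have h1 : Tendsto (fun a => P a (w a - v)) l (𝓝 0) := by
      have h2 : Tendsto (fun a => ‖w a - v‖) l (𝓝 0) := by
        simpa using (hw.sub_const v).norm
      refine squeeze_zero_norm (fun a => ?_) h2
      simpa using (P a).le_of_opNorm_le (hP1 a) (w a - v)
    have h3 := h1.add (hP v)
    rw [zero_add] at h3
    refine h3.congr fun a => ?_
    rw [← map_add, sub_add_cancel]
  have hterm : ∀ n τ, Tendsto (fun a => dysonTerm (fun s => (P a).comp (G s)) f n τ) l
      (𝓝 (dysonTerm G f n τ)) := by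
    intro n
    induction n with
    | zero => exact fun τ => tendsto_const_nhds
    | succ n ih =>
      intro τ
      simp only [dysonTerm]
      refine intervalIntegral.tendsto_integral_filter_of_dominated_convergence
        (fun s => M * ((M * |s - 1|) ^ n / n.factorial * ‖f‖)) ?_ ?_ ?_ ?_
      · exact Eventually.of_forall fun a => (continuous_clm_apply_of_bounded (hM' a) (hG' a)
          (continuous_dysonTerm (hM' a) (hG' a) f n)).aestronglyMeasurable
      · exact Eventually.of_forall fun a => Eventually.of_forall fun s _ =>
          (((P a).comp (G s)).le_of_opNorm_le (hM' a s) _).trans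
            (mul_le_mul_of_nonneg_left (norm_dysonTerm_le (hM' a) f n s) hM0)
      · exact (by fun_prop : Continuous fun s : ℝ =>
          M * ((M * |s - 1|) ^ n / n.factorial * ‖f‖)).intervalIntegrable _ _
      · exact Eventually.of_forall fun s _ => hPv _ _ (((G s).continuous.tendsto _).comp (ih s))
  exact tendsto_tsum_of_dominated_convergence (summable_dyson_bound (M * |τ - 1|) ‖f‖)
    (fun n => hterm n τ) (Eventually.of_forall fun a n => norm_dysonTerm_le (hM' a) f n τ)

end Dyson

/-! ### Growth estimates -/

section Gronwall

/-- A Gronwall inequality for growth of power type. -/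
theorem le_rpow_of_deriv_le {Q Q' : ℝ → ℝ} {δ A : ℝ} (hδ : 0 < δ) (hA : 0 ≤ A) (hQ1 : 0 ≤ Q 1)
    (hQ : ∀ τ, 1 ≤ τ → HasDerivAt Q (Q' τ) τ)
    (hle : ∀ τ, 1 ≤ τ → Q' τ ≤ δ * τ⁻¹ * Q τ + A * τ ^ (2 * δ - 1)) {τ : ℝ} (hτ : 1 ≤ τ) :
    Q τ ≤ (Q 1 + A / δ) * τ ^ (2 * δ) := by
  -- the integrating factor turns the inequality into the monotonicity of `R`
  let R : ℝ → ℝ := fun t => Q t * t ^ (-δ) - A / δ * t ^ δ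
  have hR : ∀ t, 1 ≤ t → HasDerivAt R
      (Q' t * t ^ (-δ) + Q t * (-δ * t ^ (-δ - 1)) - A / δ * (δ * t ^ (δ - 1))) t := by
    intro t ht
    have ht0 : t ≠ 0 := by linarith
    exact ((hQ t ht).mul (Real.hasDerivAt_rpow_const (Or.inl ht0))).sub
      ((Real.hasDerivAt_rpow_const (Or.inl ht0)).const_mul _)
  have hanti : AntitoneOn R (Set.Ici 1) := by
    refine antitoneOn_of_deriv_nonpos (convex_Ici 1)
      (fun t ht => (hR t ht).continuousAt.continuousWithinAt)
      (fun t ht => (hR t (interior_subset ht)).differentiableAt.differentiableWithinAt) ?_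
    intro t ht
    have ht1 : (1 : ℝ) ≤ t := interior_subset ht
    have ht0 : 0 < t := by linarith
    rw [(hR t ht1).deriv]
    have e1 : t ^ (-δ - 1) = t⁻¹ * t ^ (-δ) := by
      rw [Real.rpow_sub ht0, Real.rpow_one, div_eq_inv_mul]
    have e2 : t ^ (δ - 1) = t ^ (2 * δ - 1) * t ^ (-δ) := by
      rw [← Real.rpow_add ht0]; ring_nf
    have h1 := mul_le_mul_of_nonneg_right (hle t ht1) (Real.rpow_nonneg ht0.le (-δ))
    have e3 : A / δ * (δ * t ^ (δ - 1)) = A * (t ^ (2 * δ - 1) * t ^ (-δ)) := by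
      rw [e2]; field_simp
    rw [e1, e3]
    nlinarith [h1]
  have h1 := hanti (Set.mem_Ici.2 le_rfl) (Set.mem_Ici.2 hτ) hτ
  simp only [R, Real.one_rpow, mul_one] at h1
  have ht0 : 0 < τ := by linarith
  have hp : 1 ≤ τ ^ δ := Real.one_le_rpow hτ hδ.le
  have e4 : τ ^ (-δ) * τ ^ δ = 1 := by rw [← Real.rpow_add ht0]; simp
  have e5 : τ ^ (2 * δ) = τ ^ δ * τ ^ δ := by rw [← Real.rpow_add ht0]; ring_nf
  have hAδ : 0 ≤ A / δ := div_nonneg hA hδ.le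
  have h2 : Q τ * τ ^ (-δ) ≤ Q 1 + A / δ * τ ^ δ := by linarith
  have h3 := mul_le_mul_of_nonneg_right h2 (Real.rpow_nonneg ht0.le δ)
  rw [mul_assoc, e4, mul_one] at h3
  rw [e5]
  nlinarith [mul_nonneg hQ1 (by positivity : 0 ≤ τ ^ δ),
    mul_le_mul_of_nonneg_left hp (mul_nonneg hQ1 (by positivity : 0 ≤ τ ^ δ))]

/-- Absorption of the half-derivative cross term, by Young's inequality. -/
theorem exists_young_bound {c δ : ℝ} (hc : 0 ≤ c) (hδ : 0 < δ) :
    ∃ A, 0 ≤ A ∧ ∀ q x : ℝ, 0 ≤ q → 0 ≤ x →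
      c * (q + 2 * √(q * x)) * x ≤ δ * x ^ 2 + A * q ^ 2 := by
  set ε := δ / (4 * (c + 1)) with hε
  have hε0 : 0 < ε := by positivity
  have hcε : c * ε ≤ δ / 4 := by
    rw [hε, mul_div_assoc', div_le_div_iff₀ (by positivity) (by norm_num)]
    nlinarith
  set D := c * (1 + ε⁻¹) with hD
  have hD0 : 0 ≤ D := by positivity
  refine ⟨D ^ 2 / δ, by positivity, fun q x hq hx => ?_⟩
  have h1 : 2 * √(q * x) ≤ ε * x + ε⁻¹ * q := by
    have h2 : √(q * x) ^ 2 = (ε * x) * (ε⁻¹ * q) := by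
      rw [Real.sq_sqrt (by positivity)]; field_simp
    have h3 : 0 ≤ ε * x + ε⁻¹ * q := by positivity
    nlinarith [sq_nonneg (ε * x - ε⁻¹ * q), Real.sqrt_nonneg (q * x)]
  have h4 : c * (q + 2 * √(q * x)) * x ≤ D * q * x + c * ε * x ^ 2 := by
    have h5 := mul_le_mul_of_nonneg_right
      (mul_le_mul_of_nonneg_left (add_le_add_right h1 q) hc) hx
    refine h5.trans_eq ?_
    rw [hD]; ring
  have h6 : D * q * x ≤ δ / 2 * x ^ 2 + D ^ 2 / δ * q ^ 2 := by
    have h7 : D * q * x = (D / δ * q) * (δ * x) := by field_simp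
    have h8 : D ^ 2 / δ * q ^ 2 = δ * (D / δ * q) ^ 2 := by field_simp
    rw [h7, h8]
    nlinarith [mul_nonneg hδ.le (sq_nonneg (D / δ * q - x / 2)), mul_nonneg hδ.le (sq_nonneg x)]
  nlinarith [sq_nonneg x, mul_le_mul_of_nonneg_right hcε (sq_nonneg x)]

theorem hasDerivAt_norm_sq {E : Type} [NormedAddCommGroup E] [InnerProductSpace ℂ E]
    [NormedSpace ℝ E] {z : ℝ → E} {z' : E} {τ : ℝ} (hz : HasDerivAt z z' τ) :
    HasDerivAt (fun t => ‖z t‖ ^ 2) (2 * (inner ℂ (z τ) z').re) τ := by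
  have h1 := Complex.reCLM.hasFDerivAt.comp_hasDerivAt τ (hz.inner ℂ hz)
  have e1 : (fun t => ‖z t‖ ^ 2) = Complex.reCLM ∘ fun t => inner ℂ (z t) (z t) := by
    ext t
    exact (inner_self_eq_norm_sq (𝕜 := ℂ) (z t)).symm
  have e2 : 2 * (inner ℂ (z τ) z').re =
      Complex.reCLM (inner ℂ (z τ) z' + inner ℂ z' (z τ)) := by
    rw [map_add, Complex.reCLM_apply, Complex.reCLM_apply, two_mul, ← inner_conj_symm z' (z τ),
      Complex.conj_re]
  rw [e1, e2]
  exact h1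

theorem norm_eq_of_re_inner_eq_zero {E : Type} [NormedAddCommGroup E] [InnerProductSpace ℂ E]
    [NormedSpace ℝ E] {z z' : ℝ → E} (hz : ∀ τ, HasDerivAt z (z' τ) τ)
    (h0 : ∀ τ, (inner ℂ (z τ) (z' τ)).re = 0) (s τ : ℝ) : ‖z s‖ = ‖z τ‖ := by
  have h1 : ∀ t, HasDerivAt (fun t => ‖z t‖ ^ 2) 0 t := fun t => by
    simpa [h0] using hasDerivAt_norm_sq (hz t)
  have h2 := is_const_of_deriv_eq_zero (fun t => (h1 t).differentiableAt)
    (fun t => (h1 t).deriv) s τ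
  exact (sq_eq_sq₀ (norm_nonneg _) (norm_nonneg _)).1 h2

end Gronwall

/-! ### The interaction picture -/

section Interaction

open Filter Topology

variable {ι : Type} (h : HarmonicBasis ι) (k : ℝ) (Vc : ℝ → C(Sph, ℂ))

/-- The inverse time `1 / τ`, extended by `1` to `τ < 1`. -/
def invTime (τ : ℝ) : ℝ := (max τ 1)⁻¹

theorem invTime_of_le {τ : ℝ} (hτ : 1 ≤ τ) : invTime τ = τ⁻¹ := by rw [invTime, max_eq_left hτ]

theorem continuous_invTime : Continuous invTime := by
  refine Continuous.inv₀ (by fun_prop) fun τ => ?_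
  have := le_max_right τ 1
  linarith

/-- The generator `(i k)⁻¹ U₀⁻¹ V U₀` of the evolution in the interaction picture. -/
def HarmonicBasis.gen (t : ℝ) : L2 →L[ℂ] L2 :=
  (Complex.I * (k : ℂ))⁻¹ •
    (h.evol k (invTime t)).comp ((mulOp (Vc t)).comp (h.evol k (-invTime t)))

theorem HarmonicBasis.gen_apply (t : ℝ) (f : L2) : h.gen k Vc t f = (Complex.I * (k : ℂ))⁻¹ •
    h.evol k (invTime t) (mulOp (Vc t) (h.evol k (-invTime t) f)) := rfl

/-- A norm continuous curve of real potentials with the uniform bound `C`. -/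
structure IsPotential (Vc : ℝ → C(Sph, ℂ)) (C : ℝ) : Prop where
  cont : Continuous Vc
  bound : ∀ t θ, ‖Vc t θ‖ ≤ C
  real : ∀ t θ, (starRingEnd ℂ) (Vc t θ) = Vc t θ

variable {k Vc} {C : ℝ}

theorem norm_inv_I_mul (k : ℝ) : ‖(Complex.I * (k : ℂ))⁻¹‖ = |k|⁻¹ := by simp

theorem IsPotential.nonneg (hV : IsPotential Vc C) : 0 ≤ C :=
  (norm_nonneg _).trans (hV.bound 0 (⟨EuclideanSpace.single 0 1, by simp⟩ : Sph))

theorem HarmonicBasis.norm_gen_le (hV : IsPotential Vc C) (t : ℝ) :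
    ‖h.gen k Vc t‖ ≤ |k|⁻¹ * C := by
  refine ContinuousLinearMap.opNorm_le_bound _ (mul_nonneg (by positivity) hV.nonneg) fun f => ?_
  rw [h.gen_apply, norm_smul, norm_inv_I_mul, h.norm_evol, mul_assoc]
  refine mul_le_mul_of_nonneg_left ((norm_mulOp_le (hV.bound t) _).trans_eq ?_) (by positivity)
  rw [h.norm_evol]

theorem HarmonicBasis.norm_evol_le (r : ℝ) : ‖h.evol k r‖ ≤ 1 :=
  ContinuousLinearMap.opNorm_le_bound _ zero_le_one fun f => by rw [h.norm_evol, one_mul]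

theorem HarmonicBasis.continuous_gen (hV : IsPotential Vc C) (f : L2) :
    Continuous fun t => h.gen k Vc t f := by
  have h1 : Continuous fun t => mulOp (Vc t) (h.evol k (-invTime t) f) :=
    (mulOp.continuous.comp hV.cont).clm_apply
      ((h.continuous_evol k f).comp continuous_invTime.neg)
  have h2 := continuous_clm_apply_of_bounded (G := fun t => h.evol k (invTime t))
    (fun t => h.norm_evol_le _) (fun v => (h.continuous_evol k v).comp continuous_invTime) h1
  exact h2.const_smul (Complex.I * (k : ℂ))⁻¹

theorem HarmonicBasis.inner_evol_right (r : ℝ) (f g : L2) :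
    inner ℂ f (h.evol k r g) = inner ℂ (h.evol k (-r) f) g := by
  rw [h.inner_evol, neg_neg]

theorem HarmonicBasis.inner_gen (t : ℝ) (f g : L2) :
    inner ℂ f (h.gen k Vc t g) = (Complex.I * (k : ℂ))⁻¹ *
      inner ℂ (h.evol k (-invTime t) f) (mulOp (Vc t) (h.evol k (-invTime t) g)) := by
  rw [h.gen_apply, inner_smul_right, h.inner_evol_right]

theorem re_inv_I_mul (k : ℝ) (X : ℂ) : ((Complex.I * (k : ℂ))⁻¹ * X).re = k⁻¹ * X.im := by
  rw [mul_inv, Complex.inv_I, ← Complex.ofReal_inv]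
  simp

theorem HarmonicBasis.re_inner_gen (hV : IsPotential Vc C) (t : ℝ) (f : L2) :
    (inner ℂ f (h.gen k Vc t f)).re = 0 := by
  rw [h.inner_gen, re_inv_I_mul]
  have h1 : (starRingEnd ℂ) (inner ℂ (h.evol k (-invTime t) f)
      (mulOp (Vc t) (h.evol k (-invTime t) f))) = inner ℂ (h.evol k (-invTime t) f)
      (mulOp (Vc t) (h.evol k (-invTime t) f)) := by
    rw [inner_conj_symm, inner_mulOp_left (hV.real t)]
  rw [Complex.conj_eq_iff_im.1 h1, mul_zero]

theorem HarmonicBasis.norm_dyson (hV : IsPotential Vc C) (f : L2) (τ : ℝ) :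
    ‖dyson (h.gen k Vc) f τ‖ = ‖f‖ := by
  rw [norm_eq_of_re_inner_eq_zero
    (hasDerivAt_dyson (h.norm_gen_le hV) (h.continuous_gen hV) f)
    (fun t => h.re_inner_gen hV t _) τ 1, dyson_one]

/-- The Duhamel terms are the terms of the Dyson series in the interaction picture. -/
theorem HarmonicBasis.duhamelTerm_eq (hV : IsPotential Vc C) {V : ℝ → Sph → ℝ}
    (hVc : ∀ t, 1 ≤ t → ∀ θ, (V t θ : ℂ) = Vc t θ) (f : L2) (n : ℕ) {τ : ℝ} (hτ : 1 ≤ τ) :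
    duhamelTerm k V 1 f n τ =
      h.evol k (-invTime τ) (dysonTerm (h.gen k Vc) (h.evol k 1 f) n τ) := by
  induction n generalizing τ with
  | zero =>
    rw [duhamelTerm, h.U0_eq k one_ne_zero (by linarith), dysonTerm, ← h.evol_add,
      invTime_of_le hτ, inv_one, sub_eq_neg_add]
  | succ n ih =>
    rw [duhamelTerm, dysonTerm, ← ContinuousLinearMap.intervalIntegral_comp_comm,
      ← intervalIntegral.integral_smul]
    · refine intervalIntegral.integral_congr fun s hs => ?_
      rw [Set.uIcc_of_le hτ] at hs
      have hs1 : 1 ≤ s := hs.1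
      rw [ih hs1, mulL2_eq (Vc s) _ (hVc s hs1), h.U0_eq k (by linarith) (by linarith),
        h.gen_apply, map_smul, ← h.evol_add, invTime_of_le hs1, invTime_of_le hτ, sub_eq_neg_add]
    · exact (continuous_clm_apply_of_bounded (h.norm_gen_le hV) (h.continuous_gen hV)
        (continuous_dysonTerm (h.norm_gen_le hV) (h.continuous_gen hV) _ n)).intervalIntegrable _ _

theorem HarmonicBasis.W_eq (hV : IsPotential Vc C) {V : ℝ → Sph → ℝ}
    (hVc : ∀ t, 1 ≤ t → ∀ θ, (V t θ : ℂ) = Vc t θ) (f : L2) {τ : ℝ} (hτ : 1 ≤ τ) :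
    W k V τ f = h.evol k (-invTime τ) (dyson (h.gen k Vc) (h.evol k 1 f) τ) := by
  rw [W, U, dyson, ContinuousLinearMap.map_tsum _ (summable_dysonTerm (h.norm_gen_le hV) _ τ)]
  simp only [h.duhamelTerm_eq hV hVc f _ hτ]

end Interaction

/-! ### The energy estimate -/

section Energy

open Filter Topology

variable {ι : Type} (h : HarmonicBasis ι)

/-- The basis functions as elements of the space of smooth functions. -/
def HarmonicBasis.smoothFn (j : ι) : smoothFun := ⟨h.fn j, h.smooth j⟩

theorem HarmonicBasis.laplaceSmooth_smoothFn (j : ι) :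
    laplaceSmooth (h.smoothFn j) = (h.ev j : ℂ) • h.smoothFn j := by
  ext θ
  exact h.eigen j θ

/-- The smooth function with given coefficients. -/
def HarmonicBasis.comb (s : Finset ι) (c : ι → ℂ) : smoothFun := ∑ j ∈ s, c j • h.smoothFn j

theorem HarmonicBasis.laplaceSmooth_comb (s : Finset ι) (c : ι → ℂ) :
    laplaceSmooth (h.comb s c) = h.comb s fun j => h.ev j * c j := by
  rw [HarmonicBasis.comb, map_sum]
  refine Finset.sum_congr rfl fun j _ => ?_
  rw [map_smul, h.laplaceSmooth_smoothFn, smul_smul, mul_comm]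

theorem HarmonicBasis.toLp_comb (s : Finset ι) (c : ι → ℂ) :
    ContinuousMap.toLp 2 surf ℂ (h.comb s c : C(Sph, ℂ)) = ∑ j ∈ s, c j • h.basis j := by
  let J : smoothFun →ₗ[ℂ] L2 :=
    (ContinuousMap.toLp 2 surf ℂ : C(Sph, ℂ) →L[ℂ] L2).toLinearMap ∘ₗ smoothFun.subtype
  show J (h.comb s c) = _
  rw [HarmonicBasis.comb, map_sum]
  refine Finset.sum_congr rfl fun j _ => ?_
  rw [map_smul, h.basis_eq]
  rfl

/-- The commutator estimate for finite combinations of spherical harmonics. -/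
theorem HarmonicBasis.abs_im_inner_le {V : Sph → ℝ} (hV : SphC 2 V) {α β : ℝ} (hα : 0 ≤ α)
    (h1 : ∀ a θ, |angDeriv a V θ| ≤ α) (h2 : ∀ θ, |∑ a, angDeriv a (angDeriv a V) θ| ≤ β)
    {m : C(Sph, ℂ)} (hm : ∀ θ, (V θ : ℂ) = m θ) {s : Finset ι} {y : L2}
    (hy : diagFin h.basis 1 s y = y) :
    |(inner ℂ (diagFin h.basis h.ev s (diagFin h.basis h.ev s y)) (mulOp m y)).im| ≤
      (β * ‖y‖ + 6 * α * √(‖y‖ * ‖diagFin h.basis h.ev s y‖)) *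
        ‖diagFin h.basis h.ev s y‖ := by
  set c : ι → ℂ := fun j => inner ℂ (h.basis j) y with hc
  have ey : y = ContinuousMap.toLp 2 surf ℂ (h.comb s c : C(Sph, ℂ)) := by
    rw [h.toLp_comb]
    conv_lhs => rw [← hy, diagFin_apply]
    simp [hc]
  have ew : diagFin h.basis h.ev s y =
      ContinuousMap.toLp 2 surf ℂ (h.comb s (fun j => h.ev j * c j) : C(Sph, ℂ)) := by
    rw [h.toLp_comb, diagFin_apply]
  have eu : diagFin h.basis h.ev s (diagFin h.basis h.ev s y) =
      ContinuousMap.toLp 2 surf ℂ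
        (h.comb s (fun j => h.ev j * (h.ev j * c j)) : C(Sph, ℂ)) := by
    rw [h.toLp_comb, diagFin_diagFin, diagFin_apply]
    refine Finset.sum_congr rfl fun j _ => ?_
    rw [hc]
    push_cast
    rw [mul_assoc]
  have em : mulOp m y = ContinuousMap.toLp 2 surf ℂ (m * (h.comb s c : C(Sph, ℂ))) := by
    rw [ey, mulOp_toLp]
  rw [← inner_conj_symm, Complex.conj_im, abs_neg, eu, ew, em]
  conv_rhs => rw [ey]
  refine abs_im_inner_mul_le hV hα h1 h2 _ _ _ _ (h.comb s c).2 ?_ ?_ ?_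
  · intro θ
    rw [← h.laplaceSmooth_comb]
    rfl
  · intro θ
    rw [← h.laplaceSmooth_comb s fun j => h.ev j * c j]
    rfl
  · intro θ
    rw [ContinuousMap.mul_apply, hm]

variable {k : ℝ} {Vc : ℝ → C(Sph, ℂ)} {C : ℝ}

/-- The Galerkin approximation of the solution in the interaction picture. -/
def HarmonicBasis.galerkin (k : ℝ) (Vc : ℝ → C(Sph, ℂ)) (s : Finset ι) (f : L2) : ℝ → L2 :=
  dyson (fun t => (diagFin h.basis 1 s).comp (h.gen k Vc t)) f

theorem HarmonicBasis.norm_galerkin_gen_le (hV : IsPotential Vc C) (s : Finset ι) (t : ℝ) :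
    ‖(diagFin h.basis 1 s).comp (h.gen k Vc t)‖ ≤ |k|⁻¹ * C :=
  ((diagFin h.basis 1 s).opNorm_comp_le _).trans
    ((mul_le_mul (norm_diagFin_one_le _ s) (h.norm_gen_le hV t) (norm_nonneg _)
      zero_le_one).trans_eq (one_mul _))

theorem HarmonicBasis.hasDerivAt_galerkin (hV : IsPotential Vc C) (s : Finset ι) (f : L2)
    (τ : ℝ) : HasDerivAt (h.galerkin k Vc s f)
      (diagFin h.basis 1 s (h.gen k Vc τ (h.galerkin k Vc s f τ))) τ :=
  hasDerivAt_dyson (h.norm_galerkin_gen_le hV s)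
    (fun v => (diagFin h.basis 1 s).continuous.comp (h.continuous_gen hV v)) f τ

theorem diagFin_one_diagFin {ι E : Type} [NormedAddCommGroup E] [InnerProductSpace ℂ E]
    (b : HilbertBasis ι ℂ E) (w : ι → ℝ) (s : Finset ι) (f : E) :
    diagFin b 1 s (diagFin b w s f) = diagFin b w s f := by
  rw [diagFin_diagFin]
  simp

theorem diagFin_diagFin_one {ι E : Type} [NormedAddCommGroup E] [InnerProductSpace ℂ E]
    (b : HilbertBasis ι ℂ E) (w : ι → ℝ) (s : Finset ι) (f : E) :
    diagFin b w s (diagFin b 1 s f) = diagFin b w s f := by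
  rw [diagFin_diagFin]
  simp

theorem HarmonicBasis.diagFin_galerkin (hV : IsPotential Vc C) {s : Finset ι} {f : L2}
    (hf : diagFin h.basis 1 s f = f) (τ : ℝ) :
    diagFin h.basis 1 s (h.galerkin k Vc s f τ) = h.galerkin k Vc s f τ :=
  clm_dyson_eq_self (h.norm_galerkin_gen_le hV s)
    (fun v => (diagFin h.basis 1 s).continuous.comp (h.continuous_gen hV v))
    (fun _ _ => diagFin_one_diagFin _ _ _ _) hf τ

theorem HarmonicBasis.norm_galerkin (hV : IsPotential Vc C) {s : Finset ι} {f : L2}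
    (hf : diagFin h.basis 1 s f = f) (τ : ℝ) : ‖h.galerkin k Vc s f τ‖ = ‖f‖ := by
  rw [norm_eq_of_re_inner_eq_zero (h.hasDerivAt_galerkin hV s f) (fun t => ?_) τ 1]
  · rw [HarmonicBasis.galerkin, dyson_one]
  · rw [← inner_diagFin_left, h.diagFin_galerkin hV hf, h.re_inner_gen hV]

theorem HarmonicBasis.diagFin_evol (w : ι → ℝ) (s : Finset ι) (r : ℝ) (f : L2) :
    diagFin h.basis w s (h.evol k r f) = h.evol k r (diagFin h.basis w s f) :=
  diagFin_diagIsom _ _ _ _ _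

theorem diagFin_eq_of_subset {ι E : Type} [NormedAddCommGroup E] [InnerProductSpace ℂ E]
    (b : HilbertBasis ι ℂ E) (w : ι → ℝ) {s₀ s : Finset ι} (hs : s₀ ⊆ s) {f : E}
    (hf : diagFin b 1 s₀ f = f) : diagFin b w s f = diagFin b w s₀ f := by
  classical
  refine HilbertBasis.ext_inner b fun j => ?_
  rw [inner_diagFin, inner_diagFin]
  by_cases h0 : j ∈ s₀
  · rw [if_pos h0, if_pos (hs h0)]
  · have h1 : inner ℂ (b j) f = 0 := by
      rw [← hf, inner_diagFin, if_neg h0]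
    rw [h1, if_neg h0, mul_zero, ite_self]

/-- The rate of change of `‖B z‖²`, with the powers of `t` arranged so that Young's inequality
applies to `t ^ (2 - 2 γ) ‖z‖` and `‖B z‖`. -/
theorem HarmonicBasis.re_inner_gen_le (hV : IsPotential Vc C) {γ : ℝ}
    {V : ℝ → Sph → ℝ} {t : ℝ} (ht : 1 ≤ t)
    (hVc : ∀ θ, (V t θ : ℂ) = Vc t θ) (hV2 : SphC 2 (V t))
    (h1 : ∀ a θ, |angDeriv a (V t) θ| ≤ C * t ^ (-γ))
    (h2 : ∀ θ, |∑ a, angDeriv a (angDeriv a (V t)) θ| ≤ 3 * (C * t ^ (1 - 2 * γ)))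
    {s : Finset ι} {z : L2} (hz : diagFin h.basis 1 s z = z) :
    2 * (inner ℂ (diagFin h.basis h.ev s (diagFin h.basis h.ev s z)) (h.gen k Vc t z)).re ≤
      t⁻¹ * (6 * C / |k| * (t ^ (2 - 2 * γ) * ‖z‖ +
        2 * √(t ^ (2 - 2 * γ) * ‖z‖ * ‖diagFin h.basis h.ev s z‖)) *
          ‖diagFin h.basis h.ev s z‖) := by
  have ht0 : 0 < t := by linarith
  set y := h.evol k (-invTime t) z with hy
  have hPy : diagFin h.basis 1 s y = y := by rw [hy, h.diagFin_evol, hz]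
  have hny : ‖y‖ = ‖z‖ := h.norm_evol _ _ _
  have hnw : ‖diagFin h.basis h.ev s y‖ = ‖diagFin h.basis h.ev s z‖ := by
    rw [hy, h.diagFin_evol, h.norm_evol]
  have key := h.abs_im_inner_le hV2
    (mul_nonneg hV.nonneg (Real.rpow_nonneg ht0.le _)) h1 h2 hVc hPy
  rw [hny, hnw] at key
  rw [h.inner_gen, ← h.diagFin_evol, ← h.diagFin_evol, ← hy, re_inv_I_mul]
  have h3 := le_abs_self (k⁻¹ * (inner ℂ (diagFin h.basis h.ev s (diagFin h.basis h.ev s y))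
    (mulOp (Vc t) y)).im)
  rw [abs_mul, abs_inv] at h3
  have h4 := h3.trans (mul_le_mul_of_nonneg_left key (inv_nonneg.2 (abs_nonneg k)))
  refine (mul_le_mul_of_nonneg_left h4 zero_le_two).trans_eq ?_
  have e1 : t ^ (1 - 2 * γ) = t⁻¹ * t ^ (2 - 2 * γ) := by
    rw [← Real.rpow_neg_one, ← Real.rpow_add ht0]; ring_nf
  have e2 : t ^ (-γ) = t⁻¹ * t ^ (1 - γ) := by
    rw [← Real.rpow_neg_one, ← Real.rpow_add ht0]; ring_nf
  have e3 : √(t ^ (2 - 2 * γ) * ‖z‖ * ‖diagFin h.basis h.ev s z‖) =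
      t ^ (1 - γ) * √(‖z‖ * ‖diagFin h.basis h.ev s z‖) := by
    rw [mul_assoc, Real.sqrt_mul (by positivity), Real.sqrt_eq_rpow, ← Real.rpow_mul ht0.le]
    ring_nf
  rw [e1, e2, e3]
  ring

/-- The energy estimate: two derivatives of the Galerkin approximations grow at most like
`τ ^ (2 - 2 γ)`, uniformly in the dimension. -/
theorem HarmonicBasis.norm_diagFin_galerkin_le (hV : IsPotential Vc C) {γ : ℝ}
    (hγ1 : γ < 1) {V : ℝ → Sph → ℝ}
    (hVc : ∀ t, 1 ≤ t → ∀ θ, (V t θ : ℂ) = Vc t θ) (hV2 : ∀ t, 1 ≤ t → SphC 2 (V t))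
    (h1 : ∀ t, 1 ≤ t → ∀ a θ, |angDeriv a (V t) θ| ≤ C * t ^ (-γ))
    (h2 : ∀ t, 1 ≤ t → ∀ θ, |∑ a, angDeriv a (angDeriv a (V t)) θ| ≤ 3 * (C * t ^ (1 - 2 * γ)))
    {s₀ : Finset ι} {f : L2} (hf : diagFin h.basis 1 s₀ f = f) :
    ∃ K, 0 ≤ K ∧ ∀ s, s₀ ⊆ s → ∀ τ, 1 ≤ τ →
      ‖diagFin h.basis h.ev s (h.galerkin k Vc s f τ)‖ ≤ K * τ ^ (2 - 2 * γ) := by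
  have hδ : 0 < 2 - 2 * γ := by linarith
  obtain ⟨A, hA, hyoung⟩ := exists_young_bound (c := 6 * C / |k|)
    (div_nonneg (mul_nonneg (by norm_num) hV.nonneg) (abs_nonneg k)) hδ
  set δ := 2 - 2 * γ with hδd
  refine ⟨√(‖diagFin h.basis h.ev s₀ f‖ ^ 2 + A * ‖f‖ ^ 2 / δ), Real.sqrt_nonneg _,
    fun s hs τ hτ => ?_⟩
  have hfs : diagFin h.basis 1 s f = f := (diagFin_eq_of_subset _ _ hs hf).trans hf
  set z := h.galerkin k Vc s f with hz
  have hQ : ∀ t, HasDerivAt (fun t => ‖diagFin h.basis h.ev s (z t)‖ ^ 2)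
      (2 * (inner ℂ (diagFin h.basis h.ev s (diagFin h.basis h.ev s (z t)))
        (h.gen k Vc t (z t))).re) t := by
    intro t
    have d1 := ((diagFin h.basis h.ev s).hasFDerivAt (x := z t)).restrictScalars ℝ
      |>.comp_hasDerivAt t (h.hasDerivAt_galerkin hV s f t)
    have d2 := hasDerivAt_norm_sq d1
    simp only [ContinuousLinearMap.coe_restrictScalars', diagFin_diagFin_one] at d2
    rw [inner_diagFin_left]
    exact d2
  have hle : ∀ t, 1 ≤ t → 2 * (inner ℂ (diagFin h.basis h.ev s (diagFin h.basis h.ev s (z t)))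
      (h.gen k Vc t (z t))).re ≤ δ * t⁻¹ * ‖diagFin h.basis h.ev s (z t)‖ ^ 2 +
        A * ‖f‖ ^ 2 * t ^ (2 * δ - 1) := by
    intro t ht
    have ht0 : 0 < t := by linarith
    have b1 := h.re_inner_gen_le (k := k) hV ht (hVc t ht) (hV2 t ht) (h1 t ht) (h2 t ht)
      (h.diagFin_galerkin (k := k) hV hfs t)
    rw [h.norm_galerkin hV hfs] at b1
    have b2 := hyoung (t ^ δ * ‖f‖) ‖diagFin h.basis h.ev s (z t)‖ (by positivity)
      (norm_nonneg _)
    refine b1.trans ((mul_le_mul_of_nonneg_left b2 (inv_nonneg.2 ht0.le)).trans_eq ?_)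
    have e1 : t ^ (2 * δ - 1) = t⁻¹ * (t ^ δ) ^ 2 := by
      rw [← Real.rpow_neg_one, ← Real.rpow_natCast, ← Real.rpow_mul ht0.le, ← Real.rpow_add ht0]
      push_cast
      ring_nf
    rw [e1]
    ring
  have main := le_rpow_of_deriv_le
    (Q := fun t => ‖diagFin h.basis h.ev s (z t)‖ ^ 2) hδ (mul_nonneg hA (sq_nonneg ‖f‖))
    (sq_nonneg _)
    (fun t _ => hQ t) hle hτ
  have hz1 : z 1 = f := dyson_one f
  rw [hz1, diagFin_eq_of_subset _ _ hs hf] at main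
  have hτ0 : 0 < τ := by linarith
  refine le_of_sq_le_sq (main.trans_eq ?_) (by positivity)
  rw [mul_pow, Real.sq_sqrt (by positivity), ← Real.rpow_natCast (τ ^ δ), ← Real.rpow_mul hτ0.le]
  push_cast
  ring_nf

end Energy

/-! ### The WKB phase -/

section Gauge

open Filter Topology

theorem hasDerivAt_clm_apply_clm {E F G : Type} [NormedAddCommGroup E] [NormedSpace ℂ E]
    [NormedSpace ℝ E] [IsScalarTower ℝ ℂ E] [NormedAddCommGroup F] [NormedSpace ℂ F]
    [NormedSpace ℝ F] [IsScalarTower ℝ ℂ F] [NormedAddCommGroup G] [NormedSpace ℂ G]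
    [NormedSpace ℝ G] [IsScalarTower ℝ ℂ G] (T : E →L[ℂ] F →L[ℂ] G) {A : ℝ → E} {y : ℝ → F}
    {A' : E} {y' : F} {t : ℝ} (hA : HasDerivAt A A' t) (hy : HasDerivAt y y' t) :
    HasDerivAt (fun t => T (A t) (y t)) (T (A t) y' + T A' (y t)) t := by
  have h1 := (T.isBoundedBilinearMap.hasFDerivAt (A t, y t)).restrictScalars ℝ
  exact h1.comp_hasDerivAt t (hA.prodMk hy)

/-- The inverse `exp [-(i k)⁻¹ ∫₁ᵗ V]` of the WKB phase, as a continuous function on the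
sphere. -/
def gauge (k : ℝ) (Vc : ℝ → C(Sph, ℂ)) (t : ℝ) : C(Sph, ℂ) :=
  NormedSpace.exp (-(Complex.I * (k : ℂ))⁻¹ • ∫ s in (1 : ℝ)..t, Vc s)

variable {k : ℝ} {Vc : ℝ → C(Sph, ℂ)} {C : ℝ}

theorem hasDerivAt_gauge (hV : Continuous Vc) (t : ℝ) :
    HasDerivAt (gauge k Vc) (gauge k Vc t * (-(Complex.I * (k : ℂ))⁻¹ • Vc t)) t := by
  have h1 : HasDerivAt (fun t => ∫ s in (1 : ℝ)..t, Vc s) (Vc t) t :=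
    (hV.integral_hasStrictDerivAt 1 t).hasDerivAt
  exact (hasFDerivAt_exp (𝕂 := ℝ)).comp_hasDerivAt t
    (h1.const_smul (-(Complex.I * (k : ℂ))⁻¹))

theorem continuous_gauge (hV : Continuous Vc) : Continuous (gauge k Vc) :=
  continuous_iff_continuousAt.2 fun t => (hasDerivAt_gauge hV t).continuousAt

theorem gauge_apply (hV : Continuous Vc) (t : ℝ) (θ : Sph) :
    gauge k Vc t θ = Complex.exp (-(Complex.I * (k : ℂ))⁻¹ * ∫ s in (1 : ℝ)..t, Vc s θ) := by
  have h1 : (∫ s in (1 : ℝ)..t, Vc s) θ = ∫ s in (1 : ℝ)..t, Vc s θ :=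
    ((ContinuousMap.evalCLM ℂ θ).intervalIntegral_comp_comm (hV.intervalIntegrable 1 t)).symm
  have h2 := NormedSpace.map_exp (ContinuousMap.evalAlgHom ℂ ℂ θ)
    (ContinuousMap.evalCLM ℂ θ).continuous
    (-(Complex.I * (k : ℂ))⁻¹ • ∫ s in (1 : ℝ)..t, Vc s)
  rw [Complex.exp_eq_exp_ℂ, ← h1]
  exact h2

theorem gauge_apply_of_real (hV : Continuous Vc) {V : ℝ → Sph → ℝ}
    {t : ℝ} {θ : Sph} (hVc : ∀ s ∈ Set.uIcc 1 t, (V s θ : ℂ) = Vc s θ) :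
    gauge k Vc t θ =
      Complex.exp (-((Complex.I * (k : ℂ))⁻¹ * ((∫ s in (1 : ℝ)..t, V s θ : ℝ) : ℂ))) := by
  rw [gauge_apply hV, ← intervalIntegral.integral_ofReal, neg_mul]
  congr 3
  exact intervalIntegral.integral_congr fun s hs => (hVc s hs).symm

theorem norm_gauge_apply (hV : IsPotential Vc C) (t : ℝ) (θ : Sph) : ‖gauge k Vc t θ‖ = 1 := by
  rw [gauge_apply_of_real (V := fun s θ => (Vc s θ).re) hV.cont
    fun s _ => Complex.conj_eq_iff_re.1 (hV.real s θ), Complex.norm_exp, Complex.neg_re,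
    re_inv_I_mul, Complex.ofReal_im, mul_zero, neg_zero, Real.exp_zero]

theorem norm_mulOp_gauge_le (hV : IsPotential Vc C) (t : ℝ) (f : L2) :
    ‖mulOp (gauge k Vc t) f‖ ≤ ‖f‖ :=
  (norm_mulOp_le (fun θ => (norm_gauge_apply hV t θ).le) f).trans_eq (one_mul _)

end Gauge

/-! ### Convergence of the gauged solution -/

section Modified

open Filter Topology

variable {ι : Type} (h : HarmonicBasis ι) {k : ℝ} {Vc : ℝ → C(Sph, ℂ)} {C : ℝ}

/-- Two derivatives of the solution with initial value in the span of finitely many spherical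
harmonics grow at most like `τ ^ (2 - 2 γ)`. -/
theorem HarmonicBasis.exists_norm_diagFin_dyson_le [Countable ι] (hV : IsPotential Vc C) {γ : ℝ}
    (hγ1 : γ < 1) {V : ℝ → Sph → ℝ}
    (hVc : ∀ t, 1 ≤ t → ∀ θ, (V t θ : ℂ) = Vc t θ) (hV2 : ∀ t, 1 ≤ t → SphC 2 (V t))
    (h1 : ∀ t, 1 ≤ t → ∀ a θ, |angDeriv a (V t) θ| ≤ C * t ^ (-γ))
    (h2 : ∀ t, 1 ≤ t → ∀ θ, |∑ a, angDeriv a (angDeriv a (V t)) θ| ≤ 3 * (C * t ^ (1 - 2 * γ)))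
    {s₀ : Finset ι} {f : L2} (hf : diagFin h.basis 1 s₀ f = f) :
    ∃ K, 0 ≤ K ∧ ∀ s, ∀ τ, 1 ≤ τ →
      ‖diagFin h.basis h.ev s (dyson (h.gen k Vc) f τ)‖ ≤ K * τ ^ (2 - 2 * γ) := by
  classical
  obtain ⟨K, hK, hle⟩ := h.norm_diagFin_galerkin_le (k := k) hV hγ1 hVc hV2 h1 h2 hf
  refine ⟨K, hK, fun s τ hτ => ?_⟩
  have hlim := tendsto_dyson_galerkin (l := atTop) (h.norm_gen_le (k := k) hV)
    (h.continuous_gen hV) (norm_diagFin_one_le h.basis) (tendsto_diagFin_one h.basis) f τ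
  refine le_of_tendsto (((diagFin h.basis h.ev s).continuous.tendsto _).comp hlim).norm ?_
  filter_upwards [eventually_ge_atTop (s ∪ s₀)] with s' hs'
  refine le_trans ?_ (hle s' (Finset.union_subset_right hs') τ hτ)
  have e1 : ∀ v, diagFin h.basis h.ev s v =
      diagFin h.basis 1 s (diagFin h.basis h.ev s' v) := by
    intro v
    refine HilbertBasis.ext_inner h.basis fun j => ?_
    simp only [inner_diagFin]
    by_cases hj : j ∈ s
    · simp [hj, Finset.union_subset_left hs' hj]
    · simp [hj]
  show ‖diagFin h.basis h.ev s (h.galerkin k Vc s' f τ)‖ ≤ _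
  rw [e1]
  exact ((diagFin h.basis 1 s).le_of_opNorm_le (norm_diagFin_one_le _ s) _).trans_eq (one_mul _)

theorem HarmonicBasis.inner_evol_basis (r : ℝ) (j : ι) (f : L2) :
    inner ℂ (h.basis j) (h.evol k r f) =
      Complex.exp ((Complex.I * (k : ℂ))⁻¹ * r * h.ev j) * inner ℂ (h.basis j) f := by
  rw [← h.coe_phase]
  exact inner_diagIsom _ _ _ _

theorem hasDerivAt_invTime {t : ℝ} (ht : 1 < t) : HasDerivAt invTime (-(invTime t) ^ 2) t := by
  have h0 := hasDerivAt_inv (show t ≠ 0 by linarith)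
  rw [← inv_pow, ← invTime_of_le ht.le] at h0
  refine h0.congr_of_eventuallyEq ?_
  filter_upwards [lt_mem_nhds ht] with r hr
  exact invTime_of_le hr.le

variable (k Vc) in
/-- The solution of `i k y' = τ⁻² B y + V y` with the value `v` at `τ = 1` in the interaction
picture. -/
def HarmonicBasis.sol (v : L2) (t : ℝ) : L2 :=
  h.evol k (-invTime t) (dyson (h.gen k Vc) v t)

theorem HarmonicBasis.continuous_sol (hV : IsPotential Vc C) (v : L2) :
    Continuous (h.sol k Vc v) :=
  continuous_clm_apply_of_bounded (G := fun t => h.evol k (-invTime t))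
    (fun _ => h.norm_evol_le _) (fun w => (h.continuous_evol k w).comp continuous_invTime.neg)
    (continuous_iff_continuousAt.2 fun t =>
      (hasDerivAt_dyson (h.norm_gen_le hV) (h.continuous_gen hV) v t).continuousAt)

theorem HarmonicBasis.norm_sol (hV : IsPotential Vc C) (v : L2) (t : ℝ) :
    ‖h.sol k Vc v t‖ = ‖v‖ := by
  rw [HarmonicBasis.sol, h.norm_evol, h.norm_dyson hV]

theorem HarmonicBasis.sol_sub (hV : IsPotential Vc C) (v w : L2) (t : ℝ) :
    h.sol k Vc (v - w) t = h.sol k Vc v t - h.sol k Vc w t := by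
  rw [HarmonicBasis.sol, dyson_sub (h.norm_gen_le hV) (h.continuous_gen hV), map_sub]
  rfl

theorem HarmonicBasis.hasDerivAt_inner_sol (hV : IsPotential Vc C) (v : L2) (j : ι) {t : ℝ}
    (ht : 1 < t) :
    HasDerivAt (fun t => inner ℂ (h.basis j) (h.sol k Vc v t))
      ((Complex.I * (k : ℂ))⁻¹ * ((invTime t : ℂ) ^ 2 * h.ev j *
        inner ℂ (h.basis j) (h.sol k Vc v t) +
        inner ℂ (h.basis j) (mulOp (Vc t) (h.sol k Vc v t)))) t := by
  have d1 : HasDerivAt (fun t => (invTime t : ℂ)) (-(invTime t : ℂ) ^ 2) t := by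
    have := (hasDerivAt_invTime ht).ofReal_comp
    push_cast at this
    exact this
  have d2 : HasDerivAt (fun t => Complex.exp
      ((Complex.I * (k : ℂ))⁻¹ * ((-invTime t : ℝ) : ℂ) * h.ev j)) (Complex.exp
      ((Complex.I * (k : ℂ))⁻¹ * ((-invTime t : ℝ) : ℂ) * h.ev j) *
      ((Complex.I * (k : ℂ))⁻¹ * (invTime t : ℂ) ^ 2 * h.ev j)) t := by
    have := ((d1.neg.const_mul (Complex.I * (k : ℂ))⁻¹).mul_const (h.ev j : ℂ)).cexp
    simpa using this
  have d3 : HasDerivAt (fun t => inner ℂ (h.basis j) (dyson (h.gen k Vc) v t))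
      (inner ℂ (h.basis j) (h.gen k Vc t (dyson (h.gen k Vc) v t))) t :=
    ((innerSL ℂ (h.basis j)).hasFDerivAt).restrictScalars ℝ |>.comp_hasDerivAt t
      (hasDerivAt_dyson (h.norm_gen_le hV) (h.continuous_gen hV) v t)
  have d4 := d2.mul d3
  have e1 : inner ℂ (h.basis j) (mulOp (Vc t) (h.sol k Vc v t)) * (Complex.I * (k : ℂ))⁻¹ =
      Complex.exp ((Complex.I * (k : ℂ))⁻¹ * ((-invTime t : ℝ) : ℂ) * h.ev j) *
        inner ℂ (h.basis j) (h.gen k Vc t (dyson (h.gen k Vc) v t)) := by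
    rw [← h.inner_evol_basis, h.gen_apply, map_smul, h.evol_neg_evol, inner_smul_right, mul_comm]
    rfl
  have e2 : (fun t => inner ℂ (h.basis j) (h.sol k Vc v t)) = fun t => Complex.exp
      ((Complex.I * (k : ℂ))⁻¹ * ((-invTime t : ℝ) : ℂ) * h.ev j) *
        inner ℂ (h.basis j) (dyson (h.gen k Vc) v t) := by
    ext t
    exact h.inner_evol_basis _ _ _
  rw [mul_add, mul_comm _ (inner ℂ (h.basis j) (mulOp (Vc t) (h.sol k Vc v t))), e1, congrFun e2 t,
    e2]
  refine HasDerivAt.congr_deriv d4 ?_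
  ring

theorem HarmonicBasis.hasDerivAt_diagFin_sol (hV : IsPotential Vc C) (v : L2) (s : Finset ι)
    {t : ℝ} (ht : 1 < t) :
    HasDerivAt (fun t => diagFin h.basis 1 s (h.sol k Vc v t))
      ((Complex.I * (k : ℂ))⁻¹ • ((invTime t : ℂ) ^ 2 • diagFin h.basis h.ev s (h.sol k Vc v t) +
        diagFin h.basis 1 s (mulOp (Vc t) (h.sol k Vc v t)))) t := by
  have d1 := HasDerivAt.fun_sum (u := s) fun j _ =>
    (h.hasDerivAt_inner_sol (k := k) hV v j ht).smul_const (h.basis j)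
  simp only [diagFin_apply, Pi.one_apply, Complex.ofReal_one, one_mul]
  refine HasDerivAt.congr_deriv d1 ?_
  symm
  rw [Finset.smul_sum, ← Finset.sum_add_distrib, Finset.smul_sum]
  refine Finset.sum_congr rfl fun j _ => ?_
  module

/-- The gauged, spectrally truncated solution moves slowly: its derivative consists of the kinetic
term, which carries the integrable factor `t⁻²`, and of a commutator that vanishes as the
truncation is removed. -/
theorem HarmonicBasis.norm_gauge_diagFin_sub_le (hV : IsPotential Vc C) (v : L2) (s : Finset ι)
    {K γ : ℝ} (hB : ∀ t, 1 ≤ t →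
      ‖diagFin h.basis h.ev s (dyson (h.gen k Vc) v t)‖ ≤ K * t ^ (2 - 2 * γ))
    {a b : ℝ} (ha : 1 ≤ a) (hab : a ≤ b) :
    ‖mulOp (gauge k Vc b) (diagFin h.basis 1 s (h.sol k Vc v b)) -
      mulOp (gauge k Vc a) (diagFin h.basis 1 s (h.sol k Vc v a))‖ ≤
    (∫ t in a..b, |k|⁻¹ * (K * t ^ (-(2 * γ)))) + ∫ t in a..b, |k|⁻¹ *
      ‖diagFin h.basis 1 s (mulOp (Vc t) (h.sol k Vc v t)) -
        mulOp (Vc t) (diagFin h.basis 1 s (h.sol k Vc v t))‖ := by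
  set y := h.sol k Vc v with hy
  have hyc : Continuous y := h.continuous_sol hV v
  have hVy : Continuous fun t => mulOp (Vc t) (y t) :=
    (mulOp.continuous.comp hV.cont).clm_apply hyc
  have hVPy : Continuous fun t => mulOp (Vc t) (diagFin h.basis 1 s (y t)) :=
    (mulOp.continuous.comp hV.cont).clm_apply ((diagFin h.basis 1 s).continuous.comp hyc)
  have hcomm : Continuous fun t => diagFin h.basis 1 s (mulOp (Vc t) (y t)) -
      mulOp (Vc t) (diagFin h.basis 1 s (y t)) :=
    ((diagFin h.basis 1 s).continuous.comp hVy).sub hVPy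
  -- the derivative; the terms with `V` have combined to a commutator with the truncation
  let D : ℝ → L2 := fun t => (Complex.I * (k : ℂ))⁻¹ • mulOp (gauge k Vc t)
    ((invTime t : ℂ) ^ 2 • diagFin h.basis h.ev s (y t) +
      (diagFin h.basis 1 s (mulOp (Vc t) (y t)) - mulOp (Vc t) (diagFin h.basis 1 s (y t))))
  have hkin : Continuous fun t => (invTime t : ℂ) ^ 2 • diagFin h.basis h.ev s (y t) :=
    ((Complex.continuous_ofReal.comp continuous_invTime).pow 2).smul
      ((diagFin h.basis h.ev s).continuous.comp hyc)
  have hDc : Continuous D :=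
    ((mulOp.continuous.comp (continuous_gauge hV.cont)).clm_apply
      (hkin.add hcomm)).const_smul (Complex.I * (k : ℂ))⁻¹
  have hψ : Continuous fun t => mulOp (gauge k Vc t) (diagFin h.basis 1 s (y t)) :=
    (mulOp.continuous.comp (continuous_gauge hV.cont)).clm_apply
      ((diagFin h.basis 1 s).continuous.comp hyc)
  have hder : ∀ t ∈ Set.Ioo a b,
      HasDerivAt (fun t => mulOp (gauge k Vc t) (diagFin h.basis 1 s (y t))) (D t) t := by
    intro t ht
    have d1 := hasDerivAt_clm_apply_clm mulOp (hasDerivAt_gauge (k := k) hV.cont t)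
      (h.hasDerivAt_diagFin_sol (k := k) hV v s (ha.trans_lt ht.1))
    refine HasDerivAt.congr_deriv d1 ?_
    simp only [D, mulOp_mul, map_smul, map_add, map_sub, smul_apply]
    module
  rw [← intervalIntegral.integral_eq_sub_of_hasDerivAt_of_le hab hψ.continuousOn hder
    (hDc.intervalIntegrable _ _)]
  have hi1 : IntervalIntegrable (fun t => |k|⁻¹ * (K * t ^ (-(2 * γ)))) volume a b := by
    refine ((intervalIntegral.intervalIntegrable_rpow (Or.inr ?_)).const_mul K).const_mul |k|⁻¹
    rw [Set.uIcc_of_le hab]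
    exact fun h0 => by linarith [h0.1]
  have hi2 : IntervalIntegrable (fun t => |k|⁻¹ *
      ‖diagFin h.basis 1 s (mulOp (Vc t) (y t)) - mulOp (Vc t) (diagFin h.basis 1 s (y t))‖)
      volume a b := (hcomm.norm.const_mul |k|⁻¹).intervalIntegrable _ _
  rw [← intervalIntegral.integral_add hi1 hi2]
  refine intervalIntegral.norm_integral_le_of_norm_le hab ?_ (hi1.add hi2)
  refine Eventually.of_forall fun t ht => ?_
  have ht1 : 1 ≤ t := ha.trans ht.1.le
  have ht0 : 0 < t := by linarith
  rw [norm_smul, norm_inv_I_mul, ← mul_add]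
  refine mul_le_mul_of_nonneg_left ((norm_mulOp_gauge_le hV t _).trans
    ((norm_add_le _ _).trans (add_le_add_left ?_ _))) (by positivity)
  have e1 : t ^ (-(2 * γ)) = t⁻¹ ^ 2 * t ^ (2 - 2 * γ) := by
    rw [← Real.rpow_neg_one, ← Real.rpow_natCast, ← Real.rpow_mul ht0.le, ← Real.rpow_add ht0]
    push_cast
    ring_nf
  have e2 : ‖(invTime t : ℂ) ^ 2‖ = t⁻¹ ^ 2 := by
    rw [norm_pow, Complex.norm_real, Real.norm_eq_abs, sq_abs, invTime_of_le ht1]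
  rw [norm_smul, e2, hy, HarmonicBasis.sol, h.diagFin_evol, h.norm_evol, e1, mul_left_comm]
  exact mul_le_mul_of_nonneg_left (hB t ht1) (by positivity)

/-- The rate of convergence, for initial values with the growth bound on two derivatives. -/
theorem HarmonicBasis.norm_gauge_sub_le [Countable ι] (hV : IsPotential Vc C) (v : L2)
    {K γ : ℝ} (hK : 0 ≤ K) (hγ : 1 / 2 < γ) (hB : ∀ s, ∀ t, 1 ≤ t →
      ‖diagFin h.basis h.ev s (dyson (h.gen k Vc) v t)‖ ≤ K * t ^ (2 - 2 * γ))
    {a b : ℝ} (ha : 1 ≤ a) (hab : a ≤ b) :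
    ‖mulOp (gauge k Vc b) (h.sol k Vc v b) - mulOp (gauge k Vc a) (h.sol k Vc v a)‖ ≤
      |k|⁻¹ * K / (2 * γ - 1) * a ^ (-(2 * γ - 1)) := by
  set y := h.sol k Vc v with hy
  have hyc : Continuous y := h.continuous_sol hV v
  have hP := tendsto_diagFin_one h.basis
  have hM : ∀ t, Tendsto (fun s => mulOp (gauge k Vc t) (diagFin h.basis 1 s (y t))) atTop
      (𝓝 (mulOp (gauge k Vc t) (y t))) := fun t =>
    ((mulOp (gauge k Vc t)).continuous.tendsto _).comp (hP (y t))
  have hR : Tendsto (fun s => ∫ t in a..b, |k|⁻¹ *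
      ‖diagFin h.basis 1 s (mulOp (Vc t) (y t)) - mulOp (Vc t) (diagFin h.basis 1 s (y t))‖)
      atTop (𝓝 (∫ _ in a..b, (0 : ℝ))) := by
    refine intervalIntegral.tendsto_integral_filter_of_dominated_convergence
      (fun _ => |k|⁻¹ * (C * ‖v‖ + C * ‖v‖)) ?_ ?_ intervalIntegrable_const ?_
    · refine Eventually.of_forall fun s => Continuous.aestronglyMeasurable ?_
      have h1 : Continuous fun t => mulOp (Vc t) (y t) :=
        (mulOp.continuous.comp hV.cont).clm_apply hyc
      have h2 : Continuous fun t => mulOp (Vc t) (diagFin h.basis 1 s (y t)) :=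
        (mulOp.continuous.comp hV.cont).clm_apply ((diagFin h.basis 1 s).continuous.comp hyc)
      exact (((diagFin h.basis 1 s).continuous.comp h1).sub h2).norm.const_mul |k|⁻¹
    · refine Eventually.of_forall fun s => Eventually.of_forall fun t _ => ?_
      have hPs : ∀ w, ‖diagFin h.basis 1 s w‖ ≤ ‖w‖ := fun w =>
        ((diagFin h.basis 1 s).le_of_opNorm_le (norm_diagFin_one_le _ s) w).trans_eq (one_mul _)
      rw [norm_mul, norm_norm, Real.norm_eq_abs, abs_of_nonneg (inv_nonneg.2 (abs_nonneg k))]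
      refine mul_le_mul_of_nonneg_left ((norm_sub_le _ _).trans (add_le_add ?_ ?_))
        (by positivity)
      · refine (hPs _).trans ((norm_mulOp_le (hV.bound t) _).trans_eq ?_)
        rw [hy, h.norm_sol hV]
      · refine (norm_mulOp_le (hV.bound t) _).trans (mul_le_mul_of_nonneg_left ?_ hV.nonneg)
        exact (hPs _).trans_eq (h.norm_sol hV v t)
    · refine Eventually.of_forall fun t _ => ?_
      have h1 := ((hP (mulOp (Vc t) (y t))).sub
        (((mulOp (Vc t)).continuous.tendsto _).comp (hP (y t)))).norm.const_mul |k|⁻¹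
      rw [sub_self, norm_zero, mul_zero] at h1
      exact h1
  rw [intervalIntegral.integral_zero] at hR
  have hI : ∫ t in a..b, |k|⁻¹ * (K * t ^ (-(2 * γ))) ≤
      |k|⁻¹ * K / (2 * γ - 1) * a ^ (-(2 * γ - 1)) := by
    have h0 : (0 : ℝ) ∉ Set.uIcc a b := by
      rw [Set.uIcc_of_le hab]
      exact fun h0 => by linarith [h0.1]
    rw [intervalIntegral.integral_const_mul, intervalIntegral.integral_const_mul,
      integral_rpow (Or.inr ⟨by linarith, h0⟩)]
    have e1 : -(2 * γ) + 1 = -(2 * γ - 1) := by ring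
    have h2 : 0 < 2 * γ - 1 := by linarith
    rw [e1, div_neg, ← neg_div, neg_sub, ← mul_assoc, mul_div_assoc', div_mul_eq_mul_div]
    have h3 : 0 ≤ b ^ (-(2 * γ - 1)) := Real.rpow_nonneg (by linarith) _
    gcongr
    linarith
  have hlim := le_of_tendsto_of_tendsto' ((hM b).sub (hM a)).norm (hR.const_add _)
    fun s => h.norm_gauge_diagFin_sub_le hV v s (hB s) ha hab
  rw [add_zero] at hlim
  exact hlim.trans hI

/-- Convergence of the gauged solution, for all initial values. -/
theorem HarmonicBasis.exists_tendsto_gauge [Countable ι] (hV : IsPotential Vc C) {γ : ℝ}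
    (hγ : 1 / 2 < γ) (hγ1 : γ < 1) {V : ℝ → Sph → ℝ}
    (hVc : ∀ t, 1 ≤ t → ∀ θ, (V t θ : ℂ) = Vc t θ) (hV2 : ∀ t, 1 ≤ t → SphC 2 (V t))
    (h1 : ∀ t, 1 ≤ t → ∀ a θ, |angDeriv a (V t) θ| ≤ C * t ^ (-γ))
    (h2 : ∀ t, 1 ≤ t → ∀ θ, |∑ a, angDeriv a (angDeriv a (V t)) θ| ≤ 3 * (C * t ^ (1 - 2 * γ)))
    (v : L2) :
    ∃ w, Tendsto (fun t => mulOp (gauge k Vc t) (h.sol k Vc v t)) atTop (𝓝 w) := by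
  refine cauchySeq_tendsto_of_complete (Metric.cauchySeq_iff'.2 fun ε hε => ?_)
  -- approximate the initial value by finite combinations of spherical harmonics
  obtain ⟨s₀, hs₀⟩ := (Metric.tendsto_nhds.1 (tendsto_diagFin_one h.basis v) (ε / 3)
    (by positivity)).exists
  set v₀ := diagFin h.basis 1 s₀ v with hv₀
  rw [dist_comm, dist_eq_norm] at hs₀
  obtain ⟨K, hK, hB⟩ := h.exists_norm_diagFin_dyson_le (k := k) hV hγ1 hVc hV2 h1 h2
    (diagFin_one_diagFin h.basis 1 s₀ v)
  have hclose : ∀ t, ‖mulOp (gauge k Vc t) (h.sol k Vc v t) -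
      mulOp (gauge k Vc t) (h.sol k Vc v₀ t)‖ < ε / 3 := by
    intro t
    rw [← map_sub, ← h.sol_sub hV]
    exact ((norm_mulOp_gauge_le hV t _).trans_eq (h.norm_sol hV _ t)).trans_lt hs₀
  have hsmall : Tendsto (fun a : ℝ => |k|⁻¹ * K / (2 * γ - 1) * a ^ (-(2 * γ - 1))) atTop
      (𝓝 0) := by
    simpa using (tendsto_rpow_neg_atTop (by linarith : 0 < 2 * γ - 1)).const_mul
      (|k|⁻¹ * K / (2 * γ - 1))
  obtain ⟨N, hN1, hN⟩ := ((eventually_ge_atTop (1 : ℝ)).and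
    (hsmall.eventually_lt_const (by positivity : 0 < ε / 3))).exists
  refine ⟨N, fun n hn => ?_⟩
  have h3 := (h.norm_gauge_sub_le hV v₀ hK hγ hB hN1 hn).trans_lt hN
  have h4 := hclose n
  have h5 := hclose N
  rw [← dist_eq_norm] at h3 h4 h5
  rw [dist_comm] at h5
  linarith [dist_triangle4 (mulOp (gauge k Vc n) (h.sol k Vc v n))
    (mulOp (gauge k Vc n) (h.sol k Vc v₀ n)) (mulOp (gauge k Vc N) (h.sol k Vc v₀ N))
    (mulOp (gauge k Vc N) (h.sol k Vc v N)), dist_comm (mulOp (gauge k Vc N) (h.sol k Vc v₀ N))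
    (mulOp (gauge k Vc N) (h.sol k Vc v N))]

end Modified

/-! ### The potential as a curve of continuous functions -/

section Potential

/-- The potential, frozen for `t < 1` at its value at `t = 1`, as a curve of continuous
functions. -/
def potential (V : ℝ → Sph → ℝ)
    (hV : Continuous fun p : ℝ × Sph => V (max p.1 1) p.2) : C(ℝ, C(Sph, ℂ)) :=
  ContinuousMap.curry ⟨fun p => (V (max p.1 1) p.2 : ℂ), Complex.continuous_ofReal.comp hV⟩

end Potential

end ScalarWKB

end

theorem lemma3
    (γ : ℝ) (hγ : 1 / 2 < γ) (hγ1 : γ < 1)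
    (k : ℝ) (hk : k ≠ 0)
    (V : ℝ → ScalarWKB.Sph → ℝ)
    (hVreg : ContMDiffOn (𝓘(ℝ, ℝ).prod (𝓡 2)) 𝓘(ℝ, ℝ) 2
      (fun p : ℝ × ScalarWKB.Sph => V p.1 p.2) (Set.Ici 1 ×ˢ Set.univ))
    (C : ℝ)
    (hV : ∀ τ : ℝ, 1 ≤ τ → ∀ θ : ScalarWKB.Sph, |V τ θ| ≤ C)
    (hDV : ∀ τ : ℝ, 1 ≤ τ → ∀ θ : ScalarWKB.Sph, ∀ u : ScalarWKB.tangentPlane θ,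
      |ScalarWKB.angularD (V τ) θ u| ≤ C * τ ^ (-γ) * ‖u‖)
    (hD2V : ∀ τ : ℝ, 1 ≤ τ → ∀ θ : ScalarWKB.Sph, ∀ u v : ScalarWKB.tangentPlane θ,
      |ScalarWKB.angularD2 (V τ) θ u v| ≤ C * τ ^ (1 - 2 * γ) * (‖u‖ * ‖v‖)) :
    ∃ (Wmod : ℝ → ScalarWKB.L2 → ScalarWKB.L2) (WmodInf : ScalarWKB.L2 → ScalarWKB.L2),
      (∀ τ : ℝ, 1 ≤ τ → ∀ f : ScalarWKB.L2,
        (ScalarWKB.W k V τ f : ScalarWKB.Sph → ℂ) =ᵐ[ScalarWKB.surf] fun θ =>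
          Complex.exp ((Complex.I * (k : ℂ))⁻¹ * ((∫ s in (1 : ℝ)..τ, V s θ : ℝ) : ℂ)) *
            (Wmod τ f : ScalarWKB.Sph → ℂ) θ) ∧
      ∀ f : ScalarWKB.L2,
        Filter.Tendsto (fun τ => Wmod τ f) Filter.atTop (nhds (WmodInf f)) := by
  have hcont : Continuous fun p : ℝ × ScalarWKB.Sph => V (max p.1 1) p.2 :=
    hVreg.continuousOn.comp_continuous
      (f := fun p : ℝ × ScalarWKB.Sph => (max p.1 1, p.2)) (by fun_prop)
      fun p => ⟨Set.mem_Ici.2 (le_max_right _ _), Set.mem_univ _⟩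
  set Vc := ScalarWKB.potential V hcont with hVcdef
  have hVc : ∀ t, 1 ≤ t → ∀ θ, (V t θ : ℂ) = Vc t θ := by
    intro t ht θ
    show (V t θ : ℂ) = (V (max t 1) θ : ℂ)
    rw [max_eq_left ht]
  have hpot : ScalarWKB.IsPotential Vc C :=
    ⟨Vc.continuous, fun t θ => (Complex.norm_real _).trans_le (hV _ (le_max_right _ _) θ),
      fun t θ => Complex.conj_ofReal _⟩
  have hV2 : ∀ t, 1 ≤ t → ScalarWKB.SphC 2 (V t) := by
    intro t ht
    have hslice : ContMDiff (𝓡 2) (𝓘(ℝ, ℝ).prod (𝓡 2)) 2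
        (fun θ : ScalarWKB.Sph => ((t, θ) : ℝ × ScalarWKB.Sph)) :=
      contMDiff_const.prodMk contMDiff_id
    exact ScalarWKB.SphC.of_contMDiff
      (hVreg.comp_contMDiff hslice fun θ => ⟨ht, Set.mem_univ θ⟩)
  have h1 : ∀ t, 1 ≤ t → ∀ a θ, |ScalarWKB.angDeriv a (V t) θ| ≤ C * t ^ (-γ) := by
    intro t ht a θ
    exact ScalarWKB.abs_angDeriv_le
      (mul_nonneg hpot.nonneg (Real.rpow_nonneg (by linarith) _)) (hDV t ht θ) a
  have h2 : ∀ t, 1 ≤ t → ∀ θ, |∑ a, ScalarWKB.angDeriv a (ScalarWKB.angDeriv a (V t)) θ| ≤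
      3 * (C * t ^ (1 - 2 * γ)) := by
    intro t ht θ
    exact ScalarWKB.abs_sum_angDeriv_angDeriv_le (hV2 t ht)
      (mul_nonneg hpot.nonneg (Real.rpow_nonneg (by linarith) _)) (hD2V t ht θ)
  obtain ⟨ι, _, b, φ, lam, hφ, hlam, hb⟩ := ScalarWKB.exists_hilbertBasis_eigenfunctions
  let h : ScalarWKB.HarmonicBasis ι := ⟨b, φ, lam, hφ, hlam, hb⟩
  choose lim hlim using fun f : ScalarWKB.L2 =>
    h.exists_tendsto_gauge (k := k) hpot hγ hγ1 hVc hV2 h1 h2 (h.evol k 1 f)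
  refine ⟨fun τ f => ScalarWKB.mulOp (ScalarWKB.gauge k Vc τ) (h.sol k Vc (h.evol k 1 f) τ), lim,
    fun τ hτ f => ?_, hlim⟩
  rw [h.W_eq hpot hVc f hτ]
  filter_upwards [ScalarWKB.coeFn_mulOp (ScalarWKB.gauge k Vc τ)
    (h.sol k Vc (h.evol k 1 f) τ)] with θ hθ
  have hs : ∀ s ∈ Set.uIcc 1 τ, (V s θ : ℂ) = Vc s θ := by
    intro s hs
    rw [Set.uIcc_of_le hτ] at hs
    exact hVc s hs.1 θ
  rw [hθ, ScalarWKB.gauge_apply_of_real hpot.cont hs, ← mul_assoc, ← Complex.exp_add,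
    add_neg_cancel, Complex.exp_zero, one_mul]
  rfl
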